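/- Let $N\ge 3$. Objects $1,\dots,N$ appear one by one at moments $1,\dots,N$, all orders of their absolute ranks being equally likely. Let $R_n$ be the rank of the $n$-th object among the first $n$ objects (rank 1 is best). For $1\le n\le N$ put $$S_{1,n}=\sum_{k=n+1}^{N}\frac1{k-1},\qquad S_{2,n}=\sum_{k=n+1}^{N}\frac{n-1}{(k-1)(k-2)}\quad(n\ge 2),$$ and let $n^*$ be the least $n\ge 1$ with $S_{1,n}\le 1$ (so $n^*\geq 2$). Player 1 accepts the first object with $R_n=1$ that appears at a moment $n\ge n^*$. Player 2 observes all the other objects in the same order, learning only the rank $S_j$ of the $j$-th object that he observes among the first $j$ objects that he observes; he decides on each observed object, when it appears, on the basis of $S_1,\dots,S_j$ only, may accept one object, and obtains 1 if it is the best of all $N$ objects and 0 otherwise. A candidate is an object that is the best of those observed by Player 2 so far. For $m\ge1$ let $\mu_m$ be the moment at which the $m$-th candidate after moment $n^*$ appears. Optimal rewards. Each of the following is the supremum, over the strategies of Player 2, of his conditional probability of obtaining the best object when he has accepted none of the first $n$ objects: $v(n,-1)$, $0\le n\le N$, given that Player 1 has accepted none of the first $n$ objects; $v(n,0)$, $n^*\le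 n\le N$, given that Player 1 has accepted one of the first $n$ objects and no candidate has appeared since; and, for a history $H$ (the ranks observed by Player 2 up to moment $n$) with $\mu_m=n$, $m\geq 1$, $v(n,p_{m,n,H})$ given $H$ (here $p_{m,n,H}=P(R_n=1\mid H)$). Near-optimal count-based rule. It replaces $p_{m,n,H}$ by $\frac m{m+1}$. Put $K(n)=\lceil S_{2,n}/(1-S_{1,n})\rceil$ for $n>n^*$, and let $n_m$ be the least $n>n^*$ with $K(n)\le m$. For $m\ge 0$ and $n^*+m\le n\le N$ define $v^a(n,m)$ recursively as follows: if $n\ge n_{m+1}-1$, $$v^a(n,m)=\frac{mn}{N(m+1)}\sum_{k=n+1}^N\frac1{k-1}+\frac{n(n-1)}{N(m+1)}\sum_{k=n+1}^N\frac1{(k-1)(k-2)},$$ and if $n<n_{m+1}-1$, $$v^a(n,m)=\sum_{k=n+1}^{n_{m+1}-1}\left[\frac{mn}{(m+1)k(k-1)}+\frac{2n(n-1)}{(m+1)k(k-1)(k-2)}\right]v^a(k,m+1)+\sum_{k=n_{m+1}}^{N}\left[\frac{mn}{(m+1)N(k-1)}+\frac{n(n-1)}{(m+1)N(k-1)(k-2)}\right].$$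 Further, for $n^*-1\le n\le N$ let $v^a(n,-1)=\sum_{k=n+1}^N\frac{n\,v^a(k,0)}{k(k-1)}$, and for $0\le n<n^*-1$ let $$v^a(n,-1)=\sum_{k=n+1}^{n^*-1}r(n,k)\max\left\{\frac kN,\,v^a(k,-1)\right\}+\frac{n}{n^*-1}\,v^a(n^*-1,-1),$$ where $r(n,k)=\frac n{k(k-1)}$ for $n\ge1$ is the probability that the first object of relative rank 1 after moment $n$ appears at moment $k$, with $r(0,1)=1$ and $r(0,k)=0$ for $k\ge2$. Then $v^a$ is a lower bound on the corresponding optimal expected future reward: $v^a(n,-1)\le v(n,-1)$ for all $0\le n\le N$; $v^a(n,0)\le v(n,0)$ for all $n^*\le n\le N$; and $v^a(n,m)\le v(n,p_{m,n,H})$ for all $m\ge1$, all $n$, and every history $H$ of Player 2 with $\mu_m=n$. -/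

import Mathlib

noncomputable section

namespace StackelbergSecretary

open scoped Classical

/-! ## The threshold of Player 1 and the count-based thresholds of Player 2

Moments are the natural numbers `1, …, N`. -/

/-- `S_{1,n} = ∑_{k=n+1}^N 1/(k-1)`. -/
def S₁ (N n : ℕ) : ℝ :=
  ∑ k ∈ Finset.Icc (n + 1) N, 1 / ((k : ℝ) - 1)

/-- `S_{2,n} = ∑_{k=n+1}^N (n-1)/((k-1)(k-2))`. -/
def S₂ (N n : ℕ) : ℝ :=
  ∑ k ∈ Finset.Icc (n + 1) N, ((n : ℝ) - 1) / (((k : ℝ) - 1) * ((k : ℝ) - 2))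

/-- The moment `n*` from which Player 1 (optimally) accepts the first relatively best object:
the least moment `n ≥ 1` with `∑_{k=n+1}^N 1/(k-1) ≤ 1`. -/
def nStar (N : ℕ) : ℕ :=
  sInf {n : ℕ | 1 ≤ n ∧ S₁ N n ≤ 1}

/-- `K(n) = ⌈S_{2,n} / (1 - S_{1,n})⌉`. -/
def K (N n : ℕ) : ℤ :=
  ⌈S₂ N n / (1 - S₁ N n)⌉

/-- `n_m`: the least moment `n > n*` with `K(n) ≤ m`. The near-optimal rule accepts the `m`-th
candidate after `n*` if and only if it appears at moment `n_m` or later. -/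
def threshold (N m : ℕ) : ℕ :=
  sInf {n : ℕ | nStar N < n ∧ K N n ≤ (m : ℤ)}

/-! ## The value function of the near-optimal count-based rule -/

/-- `w^a(n,m)`: the estimated reward from accepting the next candidate, starting in `(n,m)`. -/
def wApprox (N n m : ℕ) : ℝ :=
  (m : ℝ) * n / (N * ((m : ℝ) + 1)) * (∑ k ∈ Finset.Icc (n + 1) N, 1 / ((k : ℝ) - 1))
  + (n : ℝ) * ((n : ℝ) - 1) / (N * ((m : ℝ) + 1))
      * (∑ k ∈ Finset.Icc (n + 1) N, 1 / (((k : ℝ) - 1) * ((k : ℝ) - 2)))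

/-- `v^a(n,m)` for `m ≥ 0`. If `n ≥ n_{m+1} - 1`, then the next candidate is accepted whenever it
appears. Otherwise one conditions on the moment `k` at which the next candidate appears: it is
rejected if `k < n_{m+1}` and accepted if `k ≥ n_{m+1}`. -/
def vApprox (N n m : ℕ) : ℝ :=
  if threshold N (m + 1) ≤ n + 1 then wApprox N n m
  else
    (∑ k ∈ ((Finset.Icc (n + 1) N).filter (fun k => k < threshold N (m + 1))).attach,
      ((m : ℝ) * n / (((m : ℝ) + 1) * (k.1 : ℝ) * ((k.1 : ℝ) - 1))
        + 2 * (n : ℝ) * ((n : ℝ) - 1)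
            / (((m : ℝ) + 1) * (k.1 : ℝ) * ((k.1 : ℝ) - 1) * ((k.1 : ℝ) - 2)))
        * vApprox N k.1 (m + 1))
    + ∑ k ∈ Finset.Icc (threshold N (m + 1)) N,
      ((m : ℝ) * n / (((m : ℝ) + 1) * N * ((k : ℝ) - 1))
        + (n : ℝ) * ((n : ℝ) - 1) / (((m : ℝ) + 1) * N * ((k : ℝ) - 1) * ((k : ℝ) - 2)))
termination_by N - n
decreasing_by
  have hk := k.2
  simp only [Finset.mem_filter, Finset.mem_Icc] at hk
  omega

/-- The probability that the first object of relative rank 1 after moment `n` appears at moment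
`k > n`: this is `n/(k(k-1))`; for `n = 0` the very first object has relative rank 1. -/
def nextBestProb (n k : ℕ) : ℝ :=
  if n = 0 then (if k = 1 then 1 else 0) else (n : ℝ) / ((k : ℝ) * ((k : ℝ) - 1))

/-- `v^a(n,-1)`. For `n ≥ n* - 1` one conditions on the moment at which Player 1 accepts an
object. For `n < n* - 1` one conditions on the moment `k` of the next object of relative rank 1,
which Player 2 may accept if `k < n*`; no such object appears before `n*` with probability
`n/(n*-1)`. -/
def vApproxBefore (N n : ℕ) : ℝ :=
  if nStar N ≤ n + 1 then
    ∑ k ∈ Finset.Icc (n + 1) N, (n : ℝ) * vApprox N k 0 / ((k : ℝ) * ((k : ℝ) - 1))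
  else
    (∑ k ∈ (Finset.Ico (n + 1) (nStar N)).attach,
      nextBestProb n k.1 * max ((k.1 : ℝ) / N) (vApproxBefore N k.1))
    + vApproxBefore N (nStar N - 1) * ((n : ℝ) / ((nStar N : ℝ) - 1))
termination_by nStar N - n
decreasing_by
  · have hk := k.2
    simp only [Finset.mem_Ico] at hk
    omega
  · omega

/-! ## The game

A sample point is a permutation `ω` of `Fin N`, all permutations being equally likely. The object
with index `i : Fin N` appears at moment `i + 1` and has absolute rank `ω i + 1`
(so `ω i = 0` says that it is the best of all the objects). -/

variable {N : ℕ}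

/-- `R_{i+1}`: the rank of object `i` among the objects that have appeared by then. -/
def relRank (ω : Equiv.Perm (Fin N)) (i : Fin N) : ℕ :=
  (Finset.univ.filter (fun j : Fin N => j ≤ i ∧ ω j ≤ ω i)).card

/-- Player 1 accepts object `i`: it is the first object of relative rank 1 to appear at or after
moment `n*`. -/
def IsTaken (ω : Equiv.Perm (Fin N)) (i : Fin N) : Prop :=
  nStar N ≤ (i : ℕ) + 1 ∧ relRank ω i = 1 ∧
    ∀ j : Fin N, j < i → nStar N ≤ (j : ℕ) + 1 → relRank ω j ≠ 1

/-- Player 1 has accepted one of the first `n` objects. -/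
def TakenBy (ω : Equiv.Perm (Fin N)) (n : ℕ) : Prop :=
  ∃ i : Fin N, (i : ℕ) + 1 ≤ n ∧ IsTaken ω i

/-- The rank of object `i` with respect to the objects that Player 2 has observed by then; he
observes all the objects except for the one accepted by Player 1. -/
def seenRank (ω : Equiv.Perm (Fin N)) (i : Fin N) : ℕ :=
  (Finset.univ.filter (fun j : Fin N => j ≤ i ∧ ¬ IsTaken ω j ∧ ω j ≤ ω i)).card

/-- Object `i` is a candidate according to Player 2: he observes it, and it is the best of the
objects observed by him so far. -/
def IsCandidate (ω : Equiv.Perm (Fin N)) (i : Fin N) : Prop :=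
  ¬ IsTaken ω i ∧ seenRank ω i = 1

/-- The number of candidates according to Player 2 to appear after moment `n*` and no later than
moment `n`. -/
def candidateCount (ω : Equiv.Perm (Fin N)) (n : ℕ) : ℕ :=
  (Finset.univ.filter
    (fun i : Fin N => nStar N < (i : ℕ) + 1 ∧ (i : ℕ) + 1 ≤ n ∧ IsCandidate ω i)).card

/-- `μ_m = n`: the `m`-th candidate according to Player 2 after moment `n*` appears at
moment `n`. -/
def IsCandidateTime (ω : Equiv.Perm (Fin N)) (m n : ℕ) : Prop :=
  nStar N < n ∧ (∃ i : Fin N, (i : ℕ) + 1 = n ∧ IsCandidate ω i) ∧ candidateCount ω n = m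

/-- The history of Player 2 at moment `n`: the ranks `S_1, S_2, …` of the objects that he has
observed, each with respect to the objects previously observed by him, in order of appearance. -/
def history (ω : Equiv.Perm (Fin N)) (n : ℕ) : List ℕ :=
  ((List.finRange N).filter (fun i : Fin N => (i : ℕ) + 1 ≤ n ∧ ¬ IsTaken ω i)).map (seenRank ω)

/-- A strategy of Player 2: having observed an object, he decides whether to accept it on the
basis of his history up to and including this object, and of nothing else. -/
abbrev Strategy : Type := List ℕ → Bool

/-- Player 2, observing object `i`, is told by `σ` to accept it. -/
def Wants (σ : Strategy) (ω : Equiv.Perm (Fin N)) (i : Fin N) : Prop :=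
  ¬ IsTaken ω i ∧ σ (history ω ((i : ℕ) + 1)) = true

/-- Player 2, still searching after moment `n` and using `σ` from then on, obtains the best of
all the objects. -/
def WinsAfter (n : ℕ) (σ : Strategy) (ω : Equiv.Perm (Fin N)) : Prop :=
  ∃ i : Fin N, n < (i : ℕ) + 1 ∧ Wants σ ω i ∧
    (∀ j : Fin N, n < (j : ℕ) + 1 → j < i → ¬ Wants σ ω j) ∧ (ω i : ℕ) = 0

/-- The conditional probability of `A` given `E` for a uniformly distributed permutation. -/
def condProb (A E : Set (Equiv.Perm (Fin N))) : ℝ :=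
  ((A ∩ E).ncard : ℝ) / (E.ncard : ℝ)

/-- The optimal expected future reward of Player 2 (the probability of obtaining the best of all
the objects), given the event `E`, when he has not accepted any of the first `n` objects. -/
def optimalReward (n : ℕ) (E : Set (Equiv.Perm (Fin N))) : ℝ :=
  ⨆ σ : Strategy, condProb {ω | WinsAfter n σ ω} E

variable (N) in
/-- `v(n,-1)`: neither player has accepted any of the first `n` objects. -/
def vBefore (n : ℕ) : ℝ :=
  optimalReward n {ω : Equiv.Perm (Fin N) | ¬ TakenBy ω n}

variable (N) in
/-- `v(n,0)`: Player 1 has accepted one of the first `n` objects, and Player 2 has not observed a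
candidate since. -/
def vZero (n : ℕ) : ℝ :=
  optimalReward n {ω : Equiv.Perm (Fin N) | TakenBy ω n ∧ candidateCount ω n = 0}

/-- `v(n,p_{m,n,H})`, where `H` is the history of Player 2 at moment `n` in the realization `ω`. -/
def vAt (ω : Equiv.Perm (Fin N)) (n : ℕ) : ℝ :=
  optimalReward n {ω' : Equiv.Perm (Fin N) | history ω' n = history ω n}

end StackelbergSecretary

end

/-!
Restrict Player 2 to strategies that accept candidates only. The next object has a uniformly
distributed relative rank, independent of the order of the earlier objects (exchange adjacent
ranks), so what these strategies achieve on an event satisfies a recursion `gameValue` in three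
unnormalized weights: `γ` that Player 1 is still free, `β` that he holds the best object so far,
`α` that he holds one that has been beaten. It is sublinear in the weights. Holding the best object
is the worst state for Player 2, so the value can only grow when weight is moved from `β` to `α`.
By induction along the history, `α ≥ m β` after `m` candidates, that is, `p ≥ m / (m + 1)`, whereas
`v^a` is the reward of a threshold rule computed with `p = m / (m + 1)`.
-/

noncomputable section

namespace StackelbergSecretary

open scoped Classical

/-! ## Induction and counting -/

theorem downward_induction {N : ℕ} {P : ℕ → Prop} (hbase : ∀ n, N ≤ n → P n)
    (hstep : ∀ n, n < N → P (n + 1) → P n) (n : ℕ) : P n := by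
  induction hd : N - n generalizing n with
  | zero => exact hbase n (by omega)
  | succ d ih => exact hstep n (by omega) (ih (n + 1) (by omega))

/-- The number of elements of a finite set, as a real number. -/
def realCard {α : Type*} (E : Set α) : ℝ := E.ncard

theorem realCard_nonneg {α : Type*} (E : Set α) : 0 ≤ realCard E := Nat.cast_nonneg _

theorem realCard_empty {α : Type*} : realCard (∅ : Set α) = 0 := by simp [realCard]

section RealCard

variable {α : Type*} [Finite α]

theorem realCard_mono {E F : Set α} (h : E ⊆ F) : realCard E ≤ realCard F :=
  Nat.cast_le.2 (Set.ncard_le_ncard h)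

theorem realCard_pos {E : Set α} (h : E.Nonempty) : 0 < realCard E :=
  Nat.cast_pos.2 ((Set.ncard_pos).2 h)

theorem realCard_inter_add_diff (E F : Set α) :
    realCard (E ∩ F) + realCard (E \ F) = realCard E := by
  unfold realCard
  exact_mod_cast Set.ncard_inter_add_ncard_sdiff_eq_ncard E F

theorem realCard_eq_sum_fiber {β : Type*} {E : Set α} {f : α → β} {s : Finset β}
    (hf : ∀ x, f x ∈ s) : realCard E = ∑ b ∈ s, realCard (E ∩ {x | f x = b}) := by
  have := Fintype.ofFinite α
  unfold realCard
  rw [Set.ncard_eq_toFinset_card', Finset.card_eq_sum_card_fiberwise (f := f) (t := s)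
    (fun x _ => hf x), Nat.cast_sum]
  refine Finset.sum_congr rfl fun b _ => ?_
  rw [Set.ncard_eq_toFinset_card']
  congr 2
  ext x
  simp

end RealCard

theorem card_filter_le_eq_one_iff {ι α : Type*} [Fintype ι] [LinearOrder α] {f : ι → α}
    (hf : Function.Injective f) {p : ι → Prop} {k : ι}
    [DecidablePred fun j => p j ∧ f j ≤ f k] (hk : p k) :
    (Finset.univ.filter fun j => p j ∧ f j ≤ f k).card = 1 ↔ ∀ j, p j → f k ≤ f j := by
  rw [Finset.card_eq_one]
  constructor
  · rintro ⟨a, ha⟩ j hj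
    have hmem : ∀ {i}, p i → f i ≤ f k → i = a := fun hi hik => by
      rw [← Finset.mem_singleton, ← ha]
      simp [hi, hik]
    rcases le_total (f k) (f j) with h | h
    · exact h
    · rw [hmem hj h, hmem hk le_rfl]
  · refine fun h => ⟨k, ?_⟩
    ext j
    simp only [Finset.mem_filter, Finset.mem_univ, true_and, Finset.mem_singleton]
    exact ⟨fun hj => hf (le_antisymm hj.2 (h j hj.1)), by rintro rfl; exact ⟨hk, le_rfl⟩⟩

theorem card_filter_le_orderEmbOfFin {α : Type*} [LinearOrder α] (s : Finset α) {c : ℕ}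
    (hc : s.card = c) (i : Fin c) :
    (s.filter fun x => x ≤ s.orderEmbOfFin hc i).card = i + 1 := by
  set e := s.orderEmbOfFin hc with he
  rw [← Finset.map_orderEmbOfFin_univ s hc, ← he, Finset.filter_map, Finset.card_map]
  simp [Finset.filter_ge_eq_Iic]

/-! ## The value of the game for weights of the state of Player 1 -/

/-- The value after moment `n` of the game in which Player 2 accepts candidates only and knows
only when they appear. The weights `γ`, `α`, `β` are the (unnormalized) probabilities that
Player 1 has accepted none of the first `n` objects, that he has accepted one which is not the
best so far, and that he has accepted the best so far. -/
def gameValue (N n : ℕ) (γ α β : ℝ) : ℝ :=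
  if n < N then
    gameValue N (n + 1) (n * γ / (n + 1)) (n * α / (n + 1)) (((n - 1) * β + γ) / (n + 1))
      + max ((α + β) / N) (gameValue N (n + 1) 0 ((α + β) / (n + 1)) (β / (n + 1)))
  else 0
termination_by N - n

theorem gameValue_of_lt {N n : ℕ} (h : n < N) (γ α β : ℝ) :
    gameValue N n γ α β =
      gameValue N (n + 1) (n * γ / (n + 1)) (n * α / (n + 1)) (((n - 1) * β + γ) / (n + 1))
      + max ((α + β) / N) (gameValue N (n + 1) 0 ((α + β) / (n + 1)) (β / (n + 1))) := by
  rw [gameValue, if_pos h]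

theorem gameValue_of_le {N n : ℕ} (h : N ≤ n) (γ α β : ℝ) : gameValue N n γ α β = 0 := by
  rw [gameValue, if_neg (by omega)]

theorem gameValue_add_le (N n : ℕ) (γ α β γ' α' β' : ℝ) :
    gameValue N n (γ + γ') (α + α') (β + β') ≤ gameValue N n γ α β + gameValue N n γ' α' β' := by
  induction n using downward_induction (N := N) generalizing γ α β γ' α' β' with
  | hbase n h => simp [gameValue_of_le h]
  | hstep n h ih =>
    simp only [gameValue_of_lt h]
    set A := gameValue N (n + 1) (n * γ / (n + 1)) (n * α / (n + 1)) (((n - 1) * β + γ) / (n + 1))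
    set A' := gameValue N (n + 1) (n * γ' / (n + 1)) (n * α' / (n + 1))
      (((n - 1) * β' + γ') / (n + 1))
    set B := gameValue N (n + 1) 0 ((α + β) / (n + 1)) (β / (n + 1))
    set B' := gameValue N (n + 1) 0 ((α' + β') / (n + 1)) (β' / (n + 1))
    have hpass : gameValue N (n + 1) (n * (γ + γ') / (n + 1)) (n * (α + α') / (n + 1))
        (((n - 1) * (β + β') + (γ + γ')) / (n + 1)) ≤ A + A' := by
      convert ih _ _ _ _ _ _ using 2 <;> ring
    have hreject : gameValue N (n + 1) 0 ((α + α' + (β + β')) / (n + 1)) ((β + β') / (n + 1))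
        ≤ B + B' := by
      convert ih _ _ _ _ _ _ using 2 <;> ring
    calc _ ≤ (A + A') + max ((α + β) / N + (α' + β') / N) (B + B') :=
          add_le_add hpass (max_le_max (le_of_eq (by ring)) hreject)
      _ ≤ (A + A') + (max ((α + β) / N) B + max ((α' + β') / N) B') := by
          gcongr
          exact max_add_add_le_max_add_max
      _ = _ := by ring

theorem gameValue_smul (N n : ℕ) {c : ℝ} (hc : 0 ≤ c) (γ α β : ℝ) :
    gameValue N n (c * γ) (c * α) (c * β) = c * gameValue N n γ α β := by
  induction n using downward_induction (N := N) generalizing γ α β with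
  | hbase n h => simp [gameValue_of_le h]
  | hstep n h ih =>
    simp only [gameValue_of_lt h]
    rw [mul_add, mul_max_of_nonneg _ _ hc, ← ih, ← ih]
    congr 2 <;> ring_nf

theorem gameValue_zero_zero (N n : ℕ) {β : ℝ} (hβ : 0 ≤ β) :
    gameValue N n 0 0 β = β * gameValue N n 0 0 1 := by
  simpa using gameValue_smul N n hβ 0 0 1

theorem gameValue_zero (N n : ℕ) : gameValue N n 0 0 0 = 0 := by
  simpa using gameValue_zero_zero N n le_rfl

theorem gameValue_nonneg (N : ℕ) {n : ℕ} (hn : 1 ≤ n) {γ α β : ℝ} (hγ : 0 ≤ γ) (hα : 0 ≤ α)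
    (hβ : 0 ≤ β) : 0 ≤ gameValue N n γ α β := by
  induction n using downward_induction (N := N) generalizing γ α β with
  | hbase n h => simp [gameValue_of_le h]
  | hstep n h ih =>
    rw [gameValue_of_lt h]
    have hn' : 0 ≤ (n : ℝ) - 1 := by simpa using hn
    exact add_nonneg (ih (by omega) (by positivity) (by positivity) (by positivity))
      (le_max_of_le_left (by positivity))

theorem gameValue_zero_add_le (N : ℕ) {n : ℕ} (hn : 1 ≤ n) {α β : ℝ} (hα : 0 ≤ α) (hβ : 0 ≤ β) :
    gameValue N n 0 0 (α + β) ≤ gameValue N n 0 α β := by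
  induction n using downward_induction (N := N) generalizing α β with
  | hbase n h => simp [gameValue_of_le h]
  | hstep n h ih =>
    have hn' : 0 ≤ (n : ℝ) - 1 := by simpa using hn
    simp only [gameValue_of_lt h, mul_zero, zero_div, zero_add, add_zero]
    set D := gameValue N (n + 1) 0 0 (α / (n + 1))
    have hD : 0 ≤ D := gameValue_nonneg N (by omega) le_rfl le_rfl (by positivity)
    have hpass : gameValue N (n + 1) 0 0 ((n - 1) * (α + β) / (n + 1)) + D
        ≤ gameValue N (n + 1) 0 (n * α / (n + 1)) ((n - 1) * β / (n + 1)) := by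
      refine le_of_eq_of_le ?_ (ih (by omega) (by positivity) (by positivity))
      simp only [D]
      rw [gameValue_zero_zero N _ (β := (n - 1) * (α + β) / (n + 1)) (by positivity),
        gameValue_zero_zero N _ (β := α / (n + 1)) (by positivity),
        gameValue_zero_zero N _ (β := n * α / (n + 1) + (n - 1) * β / (n + 1)) (by positivity)]
      ring
    have hreject : gameValue N (n + 1) 0 ((α + β) / (n + 1)) ((α + β) / (n + 1))
        ≤ gameValue N (n + 1) 0 ((α + β) / (n + 1)) (β / (n + 1)) + D := by
      convert gameValue_add_le N (n + 1) 0 ((α + β) / (n + 1)) (β / (n + 1)) 0 0 (α / (n + 1))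
        using 2 <;> ring
    have hmax : max ((α + β) / N)
          (gameValue N (n + 1) 0 ((α + β) / (n + 1)) ((α + β) / (n + 1)))
        ≤ max ((α + β) / N) (gameValue N (n + 1) 0 ((α + β) / (n + 1)) (β / (n + 1))) + D := by
      rw [max_add]
      exact max_le_max (le_add_of_nonneg_right hD) hreject
    linarith

theorem gameValue_mono (N : ℕ) {n : ℕ} (hn : 1 ≤ n) {α β α' β' : ℝ} (hα' : 0 ≤ α') (hβ : 0 ≤ β)
    (hle : α' ≤ α) (hsum : α' + β' = α + β) : gameValue N n 0 α' β' ≤ gameValue N n 0 α β := by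
  obtain rfl : β' = α + β - α' := by linarith
  rcases eq_or_lt_of_le (hα'.trans hle) with rfl | hα
  · obtain rfl : α' = 0 := le_antisymm hle hα'
    simp
  obtain ⟨c, rfl⟩ : ∃ c, α' = c * α := ⟨α' / α, (div_mul_cancel₀ _ hα.ne').symm⟩
  have hc₀ : 0 ≤ c := nonneg_of_mul_nonneg_left hα' hα
  have hc₁ : 0 ≤ 1 - c := sub_nonneg.2 (le_of_mul_le_mul_right (by rwa [one_mul]) hα)
  calc gameValue N n 0 (c * α) (α + β - c * α)
      = gameValue N n (c * 0 + (1 - c) * 0) (c * α + (1 - c) * 0)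
          (c * β + (1 - c) * (α + β)) := by
        congr 1 <;> ring
    _ ≤ c * gameValue N n 0 α β + (1 - c) * gameValue N n 0 0 (α + β) := by
        rw [← gameValue_smul N n hc₀, ← gameValue_smul N n hc₁]
        exact gameValue_add_le ..
    _ ≤ c * gameValue N n 0 α β + (1 - c) * gameValue N n 0 α β := by
        gcongr
        exact gameValue_zero_add_le N hn hα.le hβ
    _ = gameValue N n 0 α β := by ring

theorem gameValue_add_le_of_zero (N : ℕ) {n : ℕ} (hn : 1 ≤ n) {γ β : ℝ} (hγ : 0 ≤ γ)
    (hβ : 0 ≤ β) :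
    gameValue N n γ 0 0 + gameValue N n 0 0 β ≤ gameValue N n γ 0 β := by
  induction n using downward_induction (N := N) generalizing γ β with
  | hbase n h => simp [gameValue_of_le h]
  | hstep n h ih =>
    have hn' : 0 ≤ (n : ℝ) - 1 := by simpa using hn
    simp only [gameValue_of_lt h, mul_zero, zero_div, zero_add, add_zero, gameValue_zero,
      max_self]
    have hsplit : gameValue N (n + 1) (n * γ / (n + 1)) 0 (γ / (n + 1))
        ≤ gameValue N (n + 1) (n * γ / (n + 1)) 0 0 + gameValue N (n + 1) 0 0 (γ / (n + 1)) := by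
      simpa using gameValue_add_le N (n + 1) (n * γ / (n + 1)) 0 0 0 0 (γ / (n + 1))
    have hmerge := ih (by omega) (γ := n * γ / (n + 1)) (β := ((n - 1) * β + γ) / (n + 1))
      (by positivity) (by positivity)
    have hlin : gameValue N (n + 1) 0 0 ((n - 1) * β / (n + 1))
          + gameValue N (n + 1) 0 0 (γ / (n + 1))
        = gameValue N (n + 1) 0 0 (((n - 1) * β + γ) / (n + 1)) := by
      rw [gameValue_zero_zero N _ (β := (n - 1) * β / (n + 1)) (by positivity),
        gameValue_zero_zero N _ (β := γ / (n + 1)) (by positivity),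
        gameValue_zero_zero N _ (β := ((n - 1) * β + γ) / (n + 1)) (by positivity)]
      ring
    linarith

/-! ## The count-based value function is bounded by the value of the game -/

/-- The weight of the event that the first candidate after moment `n` appears at moment `k`, if
Player 1 has accepted one of the first `n` objects, with weights `α`, `β` as in `gameValue`. -/
def candidateWeight (n k : ℕ) (α β : ℝ) : ℝ :=
  α * n / (k * ((k : ℝ) - 1)) + 2 * β * n * ((n : ℝ) - 1) / (k * ((k : ℝ) - 1) * ((k : ℝ) - 2))

/-- The part of `candidateWeight n k α β` in which this candidate is the best of all objects. -/
def winWeight (N n k : ℕ) (α β : ℝ) : ℝ :=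
  α * n / (N * ((k : ℝ) - 1)) + β * n * ((n : ℝ) - 1) / (N * ((k : ℝ) - 1) * ((k : ℝ) - 2))

/-- The reward after moment `n`, for the weights `α`, `β`, if the next candidate is accepted if
and only if it appears at moment `t` or later, and `u k` is obtained if it appears at `k < t`. -/
def thresholdReward (N t : ℕ) (u : ℕ → ℝ) (n : ℕ) (α β : ℝ) : ℝ :=
  ∑ k ∈ Finset.Icc (n + 1) N, if k < t then candidateWeight n k α β * u k else winWeight N n k α β

theorem candidateWeight_self {n : ℕ} (hn : 2 ≤ n) (α β : ℝ) :
    candidateWeight n (n + 1) α β = (α + 2 * β) / (n + 1) := by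
  have hn' : (2 : ℝ) ≤ n := by exact_mod_cast hn
  have hn₁ : (n : ℝ) + 1 - 2 ≠ 0 := by linarith
  simp only [candidateWeight, Nat.cast_add, Nat.cast_one, add_sub_cancel_right]
  field_simp
  ring

theorem winWeight_self (N : ℕ) {n : ℕ} (hn : 2 ≤ n) (α β : ℝ) :
    winWeight N n (n + 1) α β = (α + β) / N := by
  have hn' : (2 : ℝ) ≤ n := by exact_mod_cast hn
  have hn₁ : (n : ℝ) + 1 - 2 ≠ 0 := by linarith
  simp only [winWeight, Nat.cast_add, Nat.cast_one, add_sub_cancel_right]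
  field_simp
  ring

theorem candidateWeight_succ (n k : ℕ) (α β : ℝ) :
    candidateWeight (n + 1) k (n * α / (n + 1)) ((n - 1) * β / (n + 1))
      = candidateWeight n k α β := by
  simp only [candidateWeight, Nat.cast_add, Nat.cast_one, add_sub_cancel_right]
  field_simp

theorem winWeight_succ (N n k : ℕ) (α β : ℝ) :
    winWeight N (n + 1) k (n * α / (n + 1)) ((n - 1) * β / (n + 1)) = winWeight N n k α β := by
  simp only [winWeight, Nat.cast_add, Nat.cast_one, add_sub_cancel_right]
  field_simp

theorem thresholdReward_of_lt {N n : ℕ} (hn : 2 ≤ n) (h : n < N) (t : ℕ) (u : ℕ → ℝ) (α β : ℝ) :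
    thresholdReward N t u n α β =
      thresholdReward N t u (n + 1) (n * α / (n + 1)) ((n - 1) * β / (n + 1))
      + if n + 1 < t then (α + 2 * β) / (n + 1) * u (n + 1) else (α + β) / N := by
  simp only [thresholdReward, candidateWeight_succ, winWeight_succ]
  rw [← Finset.insert_Icc_add_one_left_eq_Icc (by omega : n + 1 ≤ N),
    Finset.sum_insert (by simp), add_comm, candidateWeight_self hn, winWeight_self N hn]

theorem thresholdReward_le_gameValue {N m t n : ℕ} {u : ℕ → ℝ} (hn : 2 ≤ n)
    (hu : ∀ k, n < k → k ≤ N → ∀ α β : ℝ, 0 ≤ β → (m + 1) * β ≤ α →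
      u k * (α + β) ≤ gameValue N k 0 α β)
    {α β : ℝ} (hβ : 0 ≤ β) (hα : m * β ≤ α) :
    thresholdReward N t u n α β ≤ gameValue N n 0 α β := by
  induction n using downward_induction (N := N) generalizing α β with
  | hbase n h =>
    rw [gameValue_of_le h, thresholdReward, Finset.Icc_eq_empty (by omega), Finset.sum_empty]
  | hstep n h ih =>
    have hn' : 0 ≤ (n : ℝ) - 1 := by simpa using (by omega : 1 ≤ n)
    rw [gameValue_of_lt h, thresholdReward_of_lt hn h]
    simp only [mul_zero, zero_div, add_zero]
    refine add_le_add (ih (by omega) (fun k hk => hu k (by omega)) (by positivity) ?_) ?_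
    · rw [← mul_div_assoc]
      gcongr ?_ / _
      have : 0 ≤ m * β := by positivity
      nlinarith
    · split_ifs
      · refine le_max_of_le_right ?_
        calc (α + 2 * β) / (n + 1) * u (n + 1)
            = u (n + 1) * ((α + β) / (n + 1) + β / (n + 1)) := by ring
          _ ≤ gameValue N (n + 1) 0 ((α + β) / (n + 1)) (β / (n + 1)) := by
              refine hu (n + 1) (by omega) (by omega) _ _ (by positivity) ?_
              rw [← mul_div_assoc]
              gcongr
              linarith
      · exact le_max_left _ _

theorem vApprox_eq_thresholdReward (N n m : ℕ) :
    vApprox N n m = thresholdReward N (threshold N (m + 1)) (fun k => vApprox N k (m + 1)) n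
      (m / (m + 1)) (1 / (m + 1)) := by
  rw [vApprox, thresholdReward]
  split_ifs with h
  · rw [wApprox, Finset.mul_sum, Finset.mul_sum, ← Finset.sum_add_distrib]
    refine Finset.sum_congr rfl fun k hk => ?_
    rw [if_neg (by have := (Finset.mem_Icc.1 hk).1; omega), winWeight]
    simp only [div_eq_mul_inv, mul_inv]
    ring
  · rw [Finset.sum_ite]
    congr 1
    · refine Eq.trans ?_ (Finset.sum_attach _ _)
      refine Finset.sum_congr rfl fun k _ => ?_
      rw [candidateWeight]
      simp only [div_eq_mul_inv, mul_inv]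
      ring
    · refine Finset.sum_congr ?_ fun k _ => ?_
      · ext k
        simp only [Finset.mem_Icc, Finset.mem_filter]
        omega
      · rw [winWeight]
        simp only [div_eq_mul_inv, mul_inv]
        ring

theorem vApprox_mul_le_gameValue {N n : ℕ} (hn : 2 ≤ n) (m : ℕ) {α β : ℝ} (hβ : 0 ≤ β)
    (hα : m * β ≤ α) : vApprox N n m * (α + β) ≤ gameValue N n 0 α β := by
  induction hd : N - n using Nat.strong_induction_on generalizing n m α β with
  | _ d ih =>
    have hα₀ : 0 ≤ α := (by positivity : 0 ≤ m * β).trans hα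
    have hm : vApprox N n m ≤ gameValue N n 0 (m / (m + 1)) (1 / (m + 1)) := by
      rw [vApprox_eq_thresholdReward]
      refine thresholdReward_le_gameValue (m := m) hn (fun k hk hkN α β hβ hα => ?_)
        (by positivity) (by rw [mul_one_div])
      exact ih (N - k) (by omega) (by omega) (m + 1) hβ (by push_cast; exact hα) rfl
    calc vApprox N n m * (α + β)
        ≤ (α + β) * gameValue N n 0 (m / (m + 1)) (1 / (m + 1)) := by
          rw [mul_comm]
          gcongr
      _ = gameValue N n 0 ((α + β) * (m / (m + 1))) ((α + β) * (1 / (m + 1))) := by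
          rw [← gameValue_smul N n (by positivity), mul_zero]
      _ ≤ gameValue N n 0 α β := by
          refine gameValue_mono N (by omega) (by positivity) hβ ?_ (by field_simp)
          rw [← mul_div_assoc, div_le_iff₀ (by positivity)]
          nlinarith

theorem sum_Icc_mul_div_of_lt {N n : ℕ} (hn : 1 ≤ n) (h : n < N) (u : ℕ → ℝ) :
    ∑ k ∈ Finset.Icc (n + 1) N, (n : ℝ) * u k / ((k : ℝ) * ((k : ℝ) - 1))
      = 1 / (n + 1) * u (n + 1)
        + n / (n + 1) * ∑ k ∈ Finset.Icc (n + 1 + 1) N,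
            ((n + 1 : ℕ) : ℝ) * u k / ((k : ℝ) * ((k : ℝ) - 1)) := by
  rw [← Finset.insert_Icc_add_one_left_eq_Icc (by omega : n + 1 ≤ N),
    Finset.sum_insert (by simp), Finset.mul_sum]
  congr 1
  · push_cast
    rw [add_sub_cancel_right]
    field_simp
  · refine Finset.sum_congr rfl fun k _ => ?_
    push_cast
    field_simp

theorem sum_vApprox_le_gameValue {N n : ℕ} (hn : 1 ≤ n) :
    ∑ k ∈ Finset.Icc (n + 1) N, (n : ℝ) * vApprox N k 0 / ((k : ℝ) * ((k : ℝ) - 1))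
      ≤ gameValue N n 1 0 0 := by
  induction n using downward_induction (N := N) with
  | hbase n h =>
    rw [gameValue_of_le h, Finset.Icc_eq_empty (by omega), Finset.sum_empty]
  | hstep n h ih =>
    rw [sum_Icc_mul_div_of_lt hn h]
    have hnow : vApprox N (n + 1) 0 ≤ gameValue N (n + 1) 0 0 1 := by
      simpa using vApprox_mul_le_gameValue (N := N) (n := n + 1) (by omega) 0 (α := 0)
        (β := 1) (by norm_num) (by norm_num)
    calc _ ≤ 1 / (n + 1) * gameValue N (n + 1) 0 0 1
          + n / (n + 1) * gameValue N (n + 1) 1 0 0 := by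
          gcongr
          exact ih (by omega)
      _ = gameValue N (n + 1) (n / (n + 1)) 0 0 + gameValue N (n + 1) 0 0 (1 / (n + 1)) := by
          rw [gameValue_zero_zero N (n + 1) (β := 1 / (n + 1)) (by positivity), add_comm]
          congr 1
          simpa using (gameValue_smul N (n + 1) (by positivity : 0 ≤ (n : ℝ) / (n + 1)) 1 0 0).symm
      _ ≤ gameValue N (n + 1) (n / (n + 1)) 0 (1 / (n + 1)) :=
          gameValue_add_le_of_zero N (by omega) (by positivity) (by positivity)
      _ = gameValue N n 1 0 0 := by
          rw [gameValue_of_lt h]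
          simp [gameValue_zero]

variable {N : ℕ}

/-! ## Uniformity and independence of the relative ranks -/

/-- `ω` and `ω'` put the first `n` objects into the same order. -/
def SameOrder (n : ℕ) (ω ω' : Equiv.Perm (Fin N)) : Prop :=
  ∀ i j : Fin N, (i : ℕ) < n → (j : ℕ) < n → (ω i ≤ ω j ↔ ω' i ≤ ω' j)

/-- The event `E` is determined by the order of the first `n` objects. -/
def DeterminedBy (n : ℕ) (E : Set (Equiv.Perm (Fin N))) : Prop :=
  ∀ ω ω', SameOrder n ω ω' → ω ∈ E → ω' ∈ E

theorem SameOrder.symm {n : ℕ} {ω ω' : Equiv.Perm (Fin N)} (h : SameOrder n ω ω') :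
    SameOrder n ω' ω := fun i j hi hj => (h i j hi hj).symm

theorem SameOrder.mono {n l : ℕ} (hnl : n ≤ l) {ω ω' : Equiv.Perm (Fin N)}
    (h : SameOrder l ω ω') : SameOrder n ω ω' :=
  fun i j hi hj => h i j (hi.trans_le hnl) (hj.trans_le hnl)

theorem DeterminedBy.mono {n l : ℕ} (hnl : n ≤ l) {E : Set (Equiv.Perm (Fin N))}
    (h : DeterminedBy n E) : DeterminedBy l E :=
  fun ω ω' hs => h ω ω' (hs.mono hnl)

theorem DeterminedBy.inter {n : ℕ} {E F : Set (Equiv.Perm (Fin N))}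
    (hE : DeterminedBy n E) (hF : DeterminedBy n F) : DeterminedBy n (E ∩ F) :=
  fun ω ω' hs h => ⟨hE ω ω' hs h.1, hF ω ω' hs h.2⟩

theorem DeterminedBy.diff {n : ℕ} {E F : Set (Equiv.Perm (Fin N))}
    (hE : DeterminedBy n E) (hF : DeterminedBy n F) : DeterminedBy n (E \ F) :=
  fun ω ω' hs h => ⟨hE ω ω' hs h.1, fun h' => h.2 (hF ω' ω hs.symm h')⟩

theorem determinedBy_setOf {n : ℕ} {p : Equiv.Perm (Fin N) → Prop}
    (h : ∀ ω ω', SameOrder n ω ω' → (p ω ↔ p ω')) : DeterminedBy n {ω | p ω} :=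
  fun ω ω' hs hp => (h ω ω' hs).1 hp

/-- The absolute ranks of the objects up to `k`. -/
def prefixValues (k : Fin N) (ω : Equiv.Perm (Fin N)) : Finset (Fin N) :=
  (Finset.Iic k).map ω.toEmbedding

theorem card_prefixValues (k : Fin N) (ω : Equiv.Perm (Fin N)) :
    (prefixValues k ω).card = (k : ℕ) + 1 := by
  rw [prefixValues, Finset.card_map, Fin.card_Iic]

theorem mem_prefixValues {k i : Fin N} {ω : Equiv.Perm (Fin N)} :
    ω i ∈ prefixValues k ω ↔ i ≤ k := by
  simp [prefixValues]

theorem relRank_eq_card_prefixValues (k : Fin N) (ω : Equiv.Perm (Fin N)) :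
    relRank ω k = ((prefixValues k ω).filter (fun x => x ≤ ω k)).card := by
  rw [relRank, ← Finset.card_map ω.toEmbedding]
  congr 1
  ext x
  obtain ⟨i, rfl⟩ := ω.surjective x
  simp [prefixValues]

theorem relRank_pos (ω : Equiv.Perm (Fin N)) (k : Fin N) : 1 ≤ relRank ω k :=
  Finset.card_pos.2 ⟨k, by simp⟩

theorem relRank_le (ω : Equiv.Perm (Fin N)) (k : Fin N) : relRank ω k ≤ k + 1 := by
  rw [relRank_eq_card_prefixValues, ← card_prefixValues k ω]
  exact Finset.card_filter_le _ _

/-- The absolute ranks of the objects up to `k` in increasing order, indexed from `0`. -/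
def nthValue (k : Fin N) (ω : Equiv.Perm (Fin N)) : Fin (k + 1) ↪o Fin N :=
  (prefixValues k ω).orderEmbOfFin (card_prefixValues k ω)

theorem exists_nthValue_eq {k i : Fin N} (hi : i ≤ k) (ω : Equiv.Perm (Fin N)) :
    ∃ s, nthValue k ω s = ω i := by
  rw [← Set.mem_range, nthValue, Finset.range_orderEmbOfFin]
  exact mem_prefixValues.2 hi

theorem relRank_eq_iff {k : Fin N} {s : Fin (k + 1)} {ω : Equiv.Perm (Fin N)} :
    relRank ω k = s + 1 ↔ ω k = nthValue k ω s := by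
  obtain ⟨x, hx⟩ := exists_nthValue_eq le_rfl ω (k := k)
  rw [relRank_eq_card_prefixValues, ← hx, nthValue, card_filter_le_orderEmbOfFin,
    OrderEmbedding.eq_iff_eq, Fin.ext_iff, Nat.add_right_cancel_iff]

/-- Exchange the `a`-th and the `b`-th of the absolute ranks of the objects up to `k`. -/
def exchange (k : Fin N) (a b : Fin (k + 1)) (ω : Equiv.Perm (Fin N)) : Equiv.Perm (Fin N) :=
  Equiv.swap (nthValue k ω a) (nthValue k ω b) * ω

theorem exchange_apply {k : Fin N} (a b : Fin (k + 1)) {ω : Equiv.Perm (Fin N)} {i : Fin N}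
    {s : Fin (k + 1)} (hs : nthValue k ω s = ω i) :
    exchange k a b ω i = nthValue k ω (Equiv.swap a b s) := by
  rw [(nthValue k ω).injective.map_swap, hs, exchange, Equiv.Perm.mul_apply]

theorem nthValue_exchange {k : Fin N} (a b : Fin (k + 1)) (ω : Equiv.Perm (Fin N)) :
    nthValue k (exchange k a b ω) = nthValue k ω := by
  have hset : prefixValues k (exchange k a b ω) = prefixValues k ω := by
    refine Finset.eq_of_subset_of_card_le (fun x hx => ?_)
      (by simp only [card_prefixValues, le_rfl])
    obtain ⟨i, rfl⟩ := (exchange k a b ω).surjective x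
    obtain ⟨s, hs⟩ := exists_nthValue_eq (mem_prefixValues.1 hx) ω
    rw [exchange_apply a b hs]
    exact Finset.orderEmbOfFin_mem _ _ _
  simp only [nthValue, hset]

theorem exchange_exchange {k : Fin N} (a b : Fin (k + 1)) (ω : Equiv.Perm (Fin N)) :
    exchange k a b (exchange k a b ω) = ω := by
  rw [exchange, nthValue_exchange, exchange, Equiv.swap_mul_self_mul]

theorem relRank_exchange {k : Fin N} {a b s : Fin (k + 1)} {ω : Equiv.Perm (Fin N)}
    (hs : relRank ω k = s + 1) : relRank (exchange k a b ω) k = Equiv.swap a b s + 1 := by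
  rw [relRank_eq_iff, nthValue_exchange, exchange_apply a b (relRank_eq_iff.1 hs).symm]

theorem sameOrder_exchange {k : Fin N} {a b : Fin (k + 1)} (hab : (b : ℕ) = a + 1)
    {ω : Equiv.Perm (Fin N)} (ha : relRank ω k = a + 1) : SameOrder k ω (exchange k a b ω) := by
  have hrank : ∀ i : Fin N, (i : ℕ) < k → ∃ s, nthValue k ω s = ω i ∧ s ≠ a := by
    intro i hi
    obtain ⟨s, hs⟩ := exists_nthValue_eq (Fin.le_def.2 hi.le) ω
    refine ⟨s, hs, ?_⟩
    rintro rfl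
    have := ω.injective ((relRank_eq_iff.1 ha).trans hs)
    omega
  intro i j hi hj
  obtain ⟨x, hx, hxa⟩ := hrank i hi
  obtain ⟨y, hy, hya⟩ := hrank j hj
  rw [exchange_apply a b hx, exchange_apply a b hy, ← hx, ← hy, OrderEmbedding.le_iff_le,
    OrderEmbedding.le_iff_le, Equiv.swap_apply_def, Equiv.swap_apply_def, if_neg hxa, if_neg hya]
  split_ifs <;> omega

theorem realCard_relRank_succ {k : Fin N} {E : Set (Equiv.Perm (Fin N))} (hE : DeterminedBy k E)
    {s : ℕ} (hs : s < k) :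
    realCard (E ∩ {ω | relRank ω k = s + 1}) = realCard (E ∩ {ω | relRank ω k = s + 1 + 1}) := by
  let a : Fin (k + 1) := ⟨s, by omega⟩
  let b : Fin (k + 1) := ⟨s + 1, by omega⟩
  have hinv : Function.Involutive (exchange k a b) := exchange_exchange a b
  have hab : Set.MapsTo (exchange k a b) (E ∩ {ω | relRank ω k = a + 1})
      (E ∩ {ω | relRank ω k = b + 1}) := fun ω ⟨hω, hr⟩ =>
    ⟨hE _ _ (sameOrder_exchange rfl hr) hω,
      by rw [Set.mem_ofPred_eq, relRank_exchange hr, Equiv.swap_apply_left]⟩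
  have hba : Set.MapsTo (exchange k a b) (E ∩ {ω | relRank ω k = b + 1})
      (E ∩ {ω | relRank ω k = a + 1}) := fun ω ⟨hω, hr⟩ => by
    have hr' : relRank (exchange k a b ω) k = a + 1 := by
      rw [relRank_exchange hr, Equiv.swap_apply_right]
    have hs := sameOrder_exchange (b := b) rfl hr'
    rw [hinv] at hs
    exact ⟨hE _ _ hs.symm hω, hr'⟩
  exact le_antisymm
    (Nat.cast_le.2 (Set.ncard_le_ncard_of_injOn _ hab hinv.injective.injOn))
    (Nat.cast_le.2 (Set.ncard_le_ncard_of_injOn _ hba hinv.injective.injOn))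

theorem realCard_relRank {k : Fin N} {E : Set (Equiv.Perm (Fin N))} (hE : DeterminedBy k E)
    {r : ℕ} (hr : 1 ≤ r) (hrk : r ≤ k + 1) :
    realCard (E ∩ {ω | relRank ω k = r}) = realCard E / ((k : ℕ) + 1) := by
  have hconst : ∀ r ∈ Finset.Icc 1 ((k : ℕ) + 1),
      realCard (E ∩ {ω | relRank ω k = r}) = realCard (E ∩ {ω | relRank ω k = 1}) := by
    intro r hr
    obtain ⟨hr, hrk⟩ := Finset.mem_Icc.1 hr
    induction r, hr using Nat.le_induction with
    | base => rfl
    | succ r hr ih =>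
      obtain ⟨s, rfl⟩ : ∃ s, r = s + 1 := ⟨r - 1, by omega⟩
      rw [← realCard_relRank_succ hE (by omega), ih (by simp; omega) (by omega)]
  have hsum := realCard_eq_sum_fiber (E := E) (f := fun ω => relRank ω k)
    (s := Finset.Icc 1 (k + 1)) (fun ω => Finset.mem_Icc.2 ⟨relRank_pos ω k, relRank_le ω k⟩)
  rw [Finset.sum_congr rfl hconst, Finset.sum_const, Nat.card_Icc, nsmul_eq_mul] at hsum
  rw [hconst r (Finset.mem_Icc.2 ⟨hr, hrk⟩), hsum]
  push_cast
  field_simp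

theorem realCard_relRank_eq {k : Fin N} {E : Set (Equiv.Perm (Fin N))} (hE : DeterminedBy k E)
    {r : Equiv.Perm (Fin N) → ℕ} (hr : ∀ ω, 1 ≤ r ω) (hrk : ∀ ω, r ω ≤ k + 1)
    (hrd : ∀ ω ω', SameOrder k ω ω' → r ω = r ω') :
    realCard (E ∩ {ω | relRank ω k = r ω}) = realCard E / ((k : ℕ) + 1) := by
  have hmem : ∀ ω, r ω ∈ Finset.Icc 1 ((k : ℕ) + 1) :=
    fun ω => Finset.mem_Icc.2 ⟨hr ω, hrk ω⟩
  rw [realCard_eq_sum_fiber hmem, realCard_eq_sum_fiber (E := E) hmem, Finset.sum_div]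
  refine Finset.sum_congr rfl fun c hc => ?_
  obtain ⟨hc₁, hck⟩ := Finset.mem_Icc.1 hc
  have hd : DeterminedBy k (E ∩ {ω | r ω = c}) :=
    hE.inter (determinedBy_setOf fun ω ω' h => by rw [hrd ω ω' h])
  rw [← realCard_relRank hd hc₁ hck]
  congr 1
  ext ω
  simp only [Set.mem_inter_iff, Set.mem_ofPred_eq]
  exact ⟨fun ⟨⟨hω, hrr⟩, hrc⟩ => ⟨⟨hω, hrc⟩, hrr.trans hrc⟩,
    fun ⟨⟨hω, hrc⟩, hrr⟩ => ⟨⟨hω, hrr.trans hrc.symm⟩, hrc⟩⟩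

theorem realCard_diff_relRank {k : Fin N} {E : Set (Equiv.Perm (Fin N))}
    (hE : DeterminedBy k E) :
    realCard (E \ {ω | relRank ω k = 1}) = k * realCard E / ((k : ℕ) + 1) := by
  have h := realCard_inter_add_diff E {ω | relRank ω k = 1}
  rw [realCard_relRank hE le_rfl (by omega)] at h
  field_simp at h ⊢
  linarith

theorem realCard_diff_relRank_diff_relRank {k : Fin N} (hk : 1 ≤ (k : ℕ))
    {E : Set (Equiv.Perm (Fin N))} (hE : DeterminedBy k E) :
    realCard ((E \ {ω | relRank ω k = 1}) \ {ω | relRank ω k = 2})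
      = (k - 1) * realCard E / ((k : ℕ) + 1) := by
  have h := realCard_inter_add_diff (E \ {ω | relRank ω k = 1}) {ω | relRank ω k = 2}
  have hinter : (E \ {ω | relRank ω k = 1}) ∩ {ω | relRank ω k = 2}
      = E ∩ {ω | relRank ω k = 2} := by
    ext ω
    simp only [Set.mem_inter_iff, Set.mem_sdiff, Set.mem_ofPred_eq]
    grind
  rw [hinter, realCard_diff_relRank hE, realCard_relRank hE (by omega) (by omega)] at h
  field_simp at h ⊢
  linarith

/-- Object `k` is at least as good as each of the first `n` objects. -/
def IsBestUpTo (ω : Equiv.Perm (Fin N)) (k : Fin N) (n : ℕ) : Prop :=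
  ∀ j : Fin N, (j : ℕ) < n → ω k ≤ ω j

theorem IsBestUpTo.mono {ω : Equiv.Perm (Fin N)} {k : Fin N} {n l : ℕ} (hnl : n ≤ l)
    (h : IsBestUpTo ω k l) : IsBestUpTo ω k n :=
  fun j hj => h j (hj.trans_le hnl)

theorem isBestUpTo_congr {ω ω' : Equiv.Perm (Fin N)} {n l : ℕ} (h : SameOrder n ω ω') {k : Fin N}
    (hk : (k : ℕ) < n) (hl : l ≤ n) : IsBestUpTo ω k l ↔ IsBestUpTo ω' k l :=
  forall_congr' fun j => imp_congr_right fun hj => h k j hk (hj.trans_le hl)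

theorem relRank_eq_one_iff {ω : Equiv.Perm (Fin N)} {k : Fin N} :
    relRank ω k = 1 ↔ IsBestUpTo ω k (k + 1) := by
  rw [relRank]
  refine (card_filter_le_eq_one_iff (p := (· ≤ k)) ω.injective le_rfl).trans ?_
  exact forall_congr' fun j => imp_congr_left (by rw [Fin.le_def, Nat.lt_succ_iff])

theorem IsBestUpTo.succ {ω : Equiv.Perm (Fin N)} {i k : Fin N} (h : IsBestUpTo ω i k)
    (hk : relRank ω k ≠ 1) : IsBestUpTo ω i (k + 1) := by
  obtain ⟨j, hj, hlt⟩ : ∃ j : Fin N, (j : ℕ) < k + 1 ∧ ω j < ω k := by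
    simpa [relRank_eq_one_iff, IsBestUpTo] using hk
  have hjk : (j : ℕ) < k := by
    have : j ≠ k := by rintro rfl; exact lt_irrefl _ hlt
    omega
  intro l hl
  rcases Nat.lt_succ_iff_lt_or_eq.1 hl with hl | hl
  · exact h l hl
  · rw [Fin.ext hl]
    exact (h j hjk).trans hlt.le

theorem isBestUpTo_succ_iff {ω : Equiv.Perm (Fin N)} {i k : Fin N} (hik : i < k) :
    IsBestUpTo ω i (k + 1) ↔ IsBestUpTo ω i k ∧ relRank ω k ≠ 1 := by
  refine ⟨fun h => ⟨h.mono (Nat.le_succ _), fun hk => hik.ne (ω.injective ?_)⟩,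
    fun h => h.1.succ h.2⟩
  exact le_antisymm (h k (Nat.lt_succ_self _))
    (relRank_eq_one_iff.1 hk i (Nat.lt_succ_of_lt (Fin.lt_def.1 hik)))

theorem relRank_ne_one_of_lt {ω : Equiv.Perm (Fin N)} {i k : Fin N} (hi : (ω i : ℕ) = 0)
    (hik : i < k) : relRank ω k ≠ 1 := by
  intro hk
  have hle := relRank_eq_one_iff.1 hk i (by omega)
  exact hik.ne (ω.injective (le_antisymm (Fin.le_def.2 (by omega)) hle))

theorem IsBestUpTo.eq_zero {ω : Equiv.Perm (Fin N)} {k : Fin N} (h : IsBestUpTo ω k N) :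
    (ω k : ℕ) = 0 := by
  have : NeZero N := ⟨k.pos.ne'⟩
  simpa using h (ω.symm 0) (Fin.is_lt _)

theorem determinedBy_relRank (k : Fin N) :
    DeterminedBy (k + 1) {ω : Equiv.Perm (Fin N) | relRank ω k = 1} :=
  determinedBy_setOf fun ω ω' hs => by
    simp only [relRank_eq_one_iff]
    exact isBestUpTo_congr hs (Nat.lt_succ_self _) le_rfl

theorem realCard_best {k : Fin N} {l : ℕ} (hkl : (k : ℕ) < l) (hlN : l ≤ N)
    {E : Set (Equiv.Perm (Fin N))} (hE : DeterminedBy l E) (hbest : ∀ ω ∈ E, IsBestUpTo ω k l) :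
    realCard (E ∩ {ω | (ω k : ℕ) = 0}) = l * realCard E / N := by
  have hN : (0 : ℝ) < N := by exact_mod_cast k.pos
  induction l using downward_induction (N := N) generalizing E with
  | hbase l h =>
    obtain rfl : l = N := by omega
    have hsub : E ⊆ {ω | (ω k : ℕ) = 0} := fun ω hω => (hbest ω hω).eq_zero
    rw [Set.inter_eq_left.2 hsub]
    field_simp
  | hstep l h ih =>
    let i : Fin N := ⟨l, h⟩
    have hinter : (E \ {ω | relRank ω i = 1}) ∩ {ω | (ω k : ℕ) = 0}
        = E ∩ {ω | (ω k : ℕ) = 0} := by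
      ext ω
      exact ⟨fun hω => ⟨hω.1.1, hω.2⟩,
        fun hω => ⟨⟨hω.1, relRank_ne_one_of_lt hω.2 (Fin.lt_def.2 hkl)⟩, hω.2⟩⟩
    have hdiff : realCard (E \ {ω | relRank ω i = 1}) = l * realCard E / (l + 1) :=
      realCard_diff_relRank (k := i) hE
    rw [← hinter, ih (hkl.trans (Nat.lt_succ_self l)) h ((hE.mono (Nat.le_succ l)).diff
      (determinedBy_relRank i))
      fun ω hω => (hbest ω hω.1).succ (k := i) hω.2, hdiff]
    push_cast
    field_simp

theorem realCard_best_of_determinedBy {k : Fin N} {E : Set (Equiv.Perm (Fin N))}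
    (hE : DeterminedBy k E) : realCard (E ∩ {ω | (ω k : ℕ) = 0}) = realCard E / N := by
  have hd : DeterminedBy (k + 1) (E ∩ {ω | relRank ω k = 1}) :=
    (hE.mono (Nat.le_succ _)).inter (determinedBy_relRank k)
  have hbest := realCard_best (Nat.lt_succ_self _) k.2 hd fun ω hω => relRank_eq_one_iff.1 hω.2
  rw [realCard_relRank hE le_rfl (by omega)] at hbest
  convert hbest using 1
  · congr 1
    ext ω
    refine ⟨fun hω => ⟨⟨hω.1, relRank_eq_one_iff.2 fun j _ => Fin.le_def.2 ?_⟩, hω.2⟩,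
      fun hω => ⟨hω.1.1, hω.2⟩⟩
    exact hω.2.le.trans (Nat.zero_le _)
  · push_cast
    field_simp

/-! ## Player 1 and the observations of Player 2 -/

theorem nStar_spec (hN : 1 ≤ N) : 1 ≤ nStar N ∧ S₁ N (nStar N) ≤ 1 :=
  Nat.sInf_mem (s := {n | 1 ≤ n ∧ S₁ N n ≤ 1}) ⟨N, hN, by simp [S₁]⟩

theorem nStar_le (hN : 1 ≤ N) : nStar N ≤ N :=
  Nat.sInf_le ⟨hN, by simp [S₁]⟩

theorem two_le_nStar (hN : 3 ≤ N) : 2 ≤ nStar N := by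
  obtain ⟨hpos, hS⟩ := nStar_spec (N := N) (by omega)
  by_contra hlt
  rw [show nStar N = 1 by omega] at hS
  have hsub : ∑ k ∈ Finset.Icc (2 : ℕ) 3, 1 / ((k : ℝ) - 1) ≤ S₁ N 1 := by
    refine Finset.sum_le_sum_of_subset_of_nonneg (Finset.Icc_subset_Icc le_rfl hN) fun k hk _ => ?_
    have : (2 : ℝ) ≤ k := by exact_mod_cast (Finset.mem_Icc.1 hk).1
    exact div_nonneg zero_le_one (by linarith)
  have hsum : ∑ k ∈ Finset.Icc (2 : ℕ) 3, 1 / ((k : ℝ) - 1) = 3 / 2 := by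
    rw [Finset.sum_Icc_succ_top (by norm_num), Finset.Icc_self, Finset.sum_singleton]
    norm_num
  linarith

/-- Player 1 has accepted one of the first `n` objects, and it is the best of them. -/
def TakenTop (ω : Equiv.Perm (Fin N)) (n : ℕ) : Prop :=
  ∃ t : Fin N, (t : ℕ) + 1 ≤ n ∧ IsTaken ω t ∧ IsBestUpTo ω t n

section Congr

variable {n : ℕ} {ω ω' : Equiv.Perm (Fin N)}

theorem relRank_congr (h : SameOrder n ω ω') {i : Fin N} (hi : (i : ℕ) < n) :
    relRank ω i = relRank ω' i := by
  rw [relRank, relRank]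
  congr 1
  exact Finset.filter_congr fun j _ => and_congr_right fun hj => h j i (by omega) hi

theorem isTaken_congr (h : SameOrder n ω ω') {i : Fin N} (hi : (i : ℕ) < n) :
    IsTaken ω i ↔ IsTaken ω' i := by
  rw [IsTaken, IsTaken, relRank_congr h hi]
  refine and_congr_right fun _ => and_congr_right fun _ => forall_congr' fun j => ?_
  exact imp_congr_right fun hj => imp_congr_right fun _ => by rw [relRank_congr h (by omega)]

theorem takenBy_congr (h : SameOrder n ω ω') {l : ℕ} (hl : l ≤ n) : TakenBy ω l ↔ TakenBy ω' l :=
  exists_congr fun _ => and_congr_right fun hi => isTaken_congr h (by omega)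

theorem takenTop_congr (h : SameOrder n ω ω') {l : ℕ} (hl : l ≤ n) : TakenTop ω l ↔ TakenTop ω' l :=
  exists_congr fun _ => and_congr_right fun ht =>
    and_congr (isTaken_congr h (by omega)) (isBestUpTo_congr h (by omega) hl)

theorem seenRank_congr (h : SameOrder n ω ω') {i : Fin N} (hi : (i : ℕ) < n) :
    seenRank ω i = seenRank ω' i := by
  rw [seenRank, seenRank]
  congr 1
  refine Finset.filter_congr fun j _ => and_congr_right fun hj => ?_
  rw [isTaken_congr h (by omega), h j i (by omega) hi]

theorem isCandidate_congr (h : SameOrder n ω ω') {i : Fin N} (hi : (i : ℕ) < n) :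
    IsCandidate ω i ↔ IsCandidate ω' i := by
  rw [IsCandidate, IsCandidate, isTaken_congr h hi, seenRank_congr h hi]

theorem candidateCount_congr (h : SameOrder n ω ω') {l : ℕ} (hl : l ≤ n) :
    candidateCount ω l = candidateCount ω' l := by
  rw [candidateCount, candidateCount]
  congr 1
  refine Finset.filter_congr fun j _ => and_congr_right fun _ => and_congr_right fun hj => ?_
  rw [isCandidate_congr h (by omega)]

theorem history_congr (h : SameOrder n ω ω') {l : ℕ} (hl : l ≤ n) : history ω l = history ω' l := by
  rw [history, history]
  have hfilter : (List.finRange N).filter (fun i : Fin N => (i : ℕ) + 1 ≤ l ∧ ¬ IsTaken ω i)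
      = (List.finRange N).filter (fun i : Fin N => (i : ℕ) + 1 ≤ l ∧ ¬ IsTaken ω' i) := by
    refine List.filter_congr fun i _ => ?_
    rw [decide_eq_decide]
    exact and_congr_right fun hi => by rw [isTaken_congr h (by omega)]
  rw [hfilter]
  refine List.map_congr_left fun i hi => seenRank_congr h ?_
  rw [List.mem_filter, decide_eq_true_iff] at hi
  omega

end Congr

theorem IsTaken.eq {ω : Equiv.Perm (Fin N)} {i j : Fin N} (hi : IsTaken ω i)
    (hj : IsTaken ω j) : i = j := by
  rcases lt_trichotomy i j with h | h | h
  · exact absurd hi.2.1 (hj.2.2 i h hi.1)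
  · exact h
  · exact absurd hj.2.1 (hi.2.2 j h hj.1)

theorem takenBy_succ_iff {ω : Equiv.Perm (Fin N)} {k : Fin N} :
    TakenBy ω (k + 1) ↔ TakenBy ω k ∨ IsTaken ω k := by
  constructor
  · rintro ⟨i, hi, h⟩
    rcases Nat.lt_or_ge i k with hik | hik
    · exact Or.inl ⟨i, hik, h⟩
    · obtain rfl : i = k := Fin.ext (by omega)
      exact Or.inr h
  · rintro (⟨i, hi, h⟩ | h)
    · exact ⟨i, by omega, h⟩
    · exact ⟨k, le_rfl, h⟩

theorem TakenTop.takenBy {ω : Equiv.Perm (Fin N)} {n : ℕ} (h : TakenTop ω n) : TakenBy ω n :=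
  h.imp fun _ h => ⟨h.1, h.2.1⟩

theorem TakenBy.mono {ω : Equiv.Perm (Fin N)} {n l : ℕ} (hnl : n ≤ l) (h : TakenBy ω n) :
    TakenBy ω l := h.imp fun _ h => ⟨h.1.trans hnl, h.2⟩

theorem TakenBy.nStar_le {ω : Equiv.Perm (Fin N)} {n : ℕ} (h : TakenBy ω n) : nStar N ≤ n := by
  obtain ⟨i, hi, h⟩ := h
  exact h.1.trans hi

theorem TakenBy.one_le {ω : Equiv.Perm (Fin N)} {n : ℕ} (h : TakenBy ω n) : 1 ≤ n := by
  obtain ⟨i, hi, -⟩ := h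
  omega

theorem TakenBy.not_isTaken {ω : Equiv.Perm (Fin N)} {k : Fin N} (h : TakenBy ω k) :
    ¬ IsTaken ω k := by
  obtain ⟨i, hi, h⟩ := h
  rintro h'
  obtain rfl := h.eq h'
  omega

theorem isTaken_iff {ω : Equiv.Perm (Fin N)} {k : Fin N} (hk : nStar N ≤ k + 1)
    (h : ¬ TakenBy ω k) : IsTaken ω k ↔ relRank ω k = 1 := by
  refine ⟨fun h => h.2.1, fun hr => ⟨hk, hr, fun j hj hjn hjr => h ?_⟩⟩
  obtain ⟨i, hi, hmin⟩ := WellFounded.has_min (wellFounded_lt (α := Fin N))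
    {i | nStar N ≤ i + 1 ∧ relRank ω i = 1} ⟨j, hjn, hjr⟩
  have hij : i ≤ j := not_lt.1 (hmin j ⟨hjn, hjr⟩)
  exact ⟨i, by omega, hi.1, hi.2, fun l hl hln hlr => hmin l ⟨hln, hlr⟩ hl⟩

theorem takenTop_succ_iff {ω : Equiv.Perm (Fin N)} {k : Fin N} (h : TakenBy ω k) :
    TakenTop ω (k + 1) ↔ TakenTop ω k ∧ relRank ω k ≠ 1 := by
  obtain ⟨t, ht, htaken⟩ := h
  have htop : ∀ n, (t : ℕ) + 1 ≤ n → (TakenTop ω n ↔ IsBestUpTo ω t n) := fun n hn =>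
    ⟨fun ⟨i, _, hi, hbest⟩ => htaken.eq hi ▸ hbest, fun hbest => ⟨t, hn, htaken, hbest⟩⟩
  rw [htop k ht, htop (k + 1) (by omega), isBestUpTo_succ_iff (Fin.lt_def.2 (by omega))]

theorem seenRank_eq_one_iff {ω : Equiv.Perm (Fin N)} {k : Fin N} (hk : ¬ IsTaken ω k) :
    seenRank ω k = 1 ↔ ∀ j ≤ k, ¬ IsTaken ω j → ω k ≤ ω j := by
  simp only [seenRank, ← and_assoc, ← and_imp]
  exact card_filter_le_eq_one_iff ω.injective ⟨le_rfl, hk⟩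

theorem seenRank_eq_relRank {ω : Equiv.Perm (Fin N)} {k : Fin N}
    (h : ¬ TakenBy ω (k + 1)) : seenRank ω k = relRank ω k := by
  rw [seenRank, relRank]
  congr 1
  refine Finset.filter_congr fun j _ => and_congr_right fun hj => and_iff_right fun hT => h ?_
  exact ⟨j, by omega, hT⟩

theorem relRank_eq_seenRank_add {ω : Equiv.Perm (Fin N)} {t k : Fin N} (ht : IsTaken ω t)
    (htk : t ≤ k) : relRank ω k = seenRank ω k + if ω t ≤ ω k then 1 else 0 := by
  have htaken : (Finset.univ.filter fun j => (j ≤ k ∧ ω j ≤ ω k) ∧ IsTaken ω j)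
      = if ω t ≤ ω k then {t} else ∅ := by
    ext j
    have hj : IsTaken ω j ↔ j = t := ⟨fun hj => hj.eq ht, fun hj => hj ▸ ht⟩
    split_ifs with h <;> simp only [Finset.mem_filter, Finset.mem_univ, true_and, hj,
      Finset.mem_singleton, Finset.notMem_empty, iff_false] <;> grind
  rw [relRank, seenRank, ← Finset.card_filter_add_card_filter_not (IsTaken ω), add_comm,
    Finset.filter_filter, Finset.filter_filter, htaken]
  congr 1
  · congr 1
    exact Finset.filter_congr fun j _ => by tauto
  · split_ifs <;> simp

theorem seenRank_pos {ω : Equiv.Perm (Fin N)} {k : Fin N} (hk : ¬ IsTaken ω k) :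
    1 ≤ seenRank ω k :=
  Finset.card_pos.2 ⟨k, by simp [hk]⟩

theorem TakenTop.isCandidate_iff {ω : Equiv.Perm (Fin N)} {k : Fin N} (h : TakenTop ω k) :
    IsCandidate ω k ↔ relRank ω k = 1 ∨ relRank ω k = 2 := by
  have hk := h.takenBy.not_isTaken
  obtain ⟨t, ht, htaken, hbest⟩ := h
  have htk : t < k := Fin.lt_def.2 (by omega)
  have hr := relRank_eq_seenRank_add htaken htk.le
  have hle : ω t ≤ ω k ↔ relRank ω k ≠ 1 := by
    rw [← not_iff_not, not_le, not_not, relRank_eq_one_iff]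
    refine ⟨fun hlt j hj => ?_, fun h => lt_of_le_of_ne (h t (by omega)) fun heq =>
      htk.ne (ω.injective heq.symm)⟩
    rcases Nat.lt_succ_iff_lt_or_eq.1 hj with hj | hj
    · exact hlt.le.trans (hbest j hj)
    · rw [Fin.ext hj]
  have := seenRank_pos hk
  rw [IsCandidate, and_iff_right hk]
  by_cases hr₁ : relRank ω k = 1
  · rw [if_neg (by simp [hle, hr₁])] at hr
    omega
  · rw [if_pos (hle.2 hr₁)] at hr
    omega

theorem TakenBy.isCandidate_iff {ω : Equiv.Perm (Fin N)} {k : Fin N} (h : TakenBy ω k)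
    (htop : ¬ TakenTop ω k) : IsCandidate ω k ↔ relRank ω k = 1 := by
  have hk := h.not_isTaken
  obtain ⟨t, ht, htaken⟩ := h
  obtain ⟨i, hi, hit⟩ : ∃ i : Fin N, (i : ℕ) < k ∧ ω i < ω t := by
    by_contra! hbest
    exact htop ⟨t, ht, htaken, hbest⟩
  have hi' : ¬ IsTaken ω i := fun h => hit.ne (congrArg ω (h.eq htaken))
  rw [IsCandidate, and_iff_right hk, seenRank_eq_one_iff hk, relRank_eq_one_iff]
  refine ⟨fun hs j hj => ?_, fun hs j hj _ => hs j (by omega)⟩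
  by_cases hjt : IsTaken ω j
  · rw [hjt.eq htaken]
    exact (hs i (Fin.le_def.2 hi.le) hi').trans hit.le
  · exact hs j (Fin.le_def.2 (Nat.lt_succ_iff.1 hj)) hjt

theorem takenBy_succ_iff_relRank {ω : Equiv.Perm (Fin N)} {k : Fin N} (hk : nStar N ≤ k + 1)
    (h : ¬ TakenBy ω k) : TakenBy ω (k + 1) ↔ relRank ω k = 1 := by
  rw [takenBy_succ_iff, isTaken_iff hk h, or_iff_right h]

theorem takenTop_succ_iff_relRank {ω : Equiv.Perm (Fin N)} {k : Fin N} (hk : nStar N ≤ k + 1)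
    (h : ¬ TakenBy ω k) : TakenTop ω (k + 1) ↔ relRank ω k = 1 :=
  ⟨fun htop => (takenBy_succ_iff_relRank hk h).1 htop.takenBy,
    fun hr => ⟨k, le_rfl, (isTaken_iff hk h).2 hr, relRank_eq_one_iff.1 hr⟩⟩

theorem not_isCandidate_of_not_takenBy {ω : Equiv.Perm (Fin N)} {k : Fin N}
    (hk : nStar N ≤ k + 1) (h : ¬ TakenBy ω k) : ¬ IsCandidate ω k := by
  rintro ⟨hT, hs⟩
  have h' : ¬ TakenBy ω (k + 1) := by simp [takenBy_succ_iff, h, hT]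
  rw [seenRank_eq_relRank h'] at hs
  exact hT ((isTaken_iff hk h).2 hs)

theorem isCandidate_iff_of_not_takenBy {ω : Equiv.Perm (Fin N)} {k : Fin N}
    (h : ¬ TakenBy ω (k + 1)) : IsCandidate ω k ↔ relRank ω k = 1 := by
  rw [IsCandidate, seenRank_eq_relRank h, and_iff_right fun hT => h ⟨k, le_rfl, hT⟩]

theorem history_eq_take (ω : Equiv.Perm (Fin N)) (n : ℕ) :
    history ω n = (((List.finRange N).take n).filter (fun i => ¬ IsTaken ω i)).map
      (seenRank ω) := by
  have htake : ∀ i ∈ (List.finRange N).take n, (i : ℕ) + 1 ≤ n := fun i hi => by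
    obtain ⟨l, hl, rfl⟩ := List.mem_take_iff_getElem.1 hi
    simp only [List.getElem_finRange, Fin.val_cast]
    omega
  have hdrop : ∀ i ∈ (List.finRange N).drop n, ¬ (i : ℕ) + 1 ≤ n := fun i hi => by
    obtain ⟨l, hl, rfl⟩ := List.mem_drop_iff_getElem.1 hi
    simp only [List.getElem_finRange, Fin.val_cast]
    omega
  rw [history]
  conv_lhs => rw [← List.take_append_drop n (List.finRange N)]
  rw [List.filter_append, List.filter_eq_nil_iff (l := List.drop _ _) |>.2 fun i hi => by
    simp only [hdrop i hi, false_and, decide_false, Bool.false_eq_true, not_false_iff],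
    List.append_nil]
  congr 1
  exact List.filter_congr fun i hi => decide_eq_decide.2 (and_iff_right (htake i hi))

theorem history_succ (ω : Equiv.Perm (Fin N)) (k : Fin N) :
    history ω (k + 1) = history ω k ++ if IsTaken ω k then [] else [seenRank ω k] := by
  rw [history_eq_take, history_eq_take, List.take_add_one, List.filter_append, List.map_append,
    List.getElem?_eq_getElem (by simp), List.getElem_finRange]
  by_cases h : IsTaken ω k <;> simp [h]

theorem history_prefix (ω : Equiv.Perm (Fin N)) {n l : ℕ} (hnl : n ≤ l) :
    history ω n <+: history ω l := by
  rw [history_eq_take, history_eq_take]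
  exact ((List.take_prefix_take_left hnl).filter _).map _

theorem length_history_of_not_takenBy {ω : Equiv.Perm (Fin N)} {n : ℕ} (h : ¬ TakenBy ω n)
    (hn : n ≤ N) : (history ω n).length = n := by
  induction n with
  | zero => simp [history_eq_take]
  | succ n ih =>
    let k : Fin N := ⟨n, hn⟩
    obtain ⟨hT, hk⟩ := not_or.1 ((not_congr (takenBy_succ_iff (k := k))).1 h)
    rw [history_succ ω k, if_neg hk, List.length_append, ih hT (by omega), List.length_singleton]

theorem TakenBy.length_history {ω : Equiv.Perm (Fin N)} {n : ℕ} (h : TakenBy ω n) (hn : n ≤ N) :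
    (history ω n).length = n - 1 := by
  induction n with
  | zero => simp [history_eq_take]
  | succ n ih =>
    let k : Fin N := ⟨n, hn⟩
    rw [history_succ ω k, List.length_append, Nat.add_sub_cancel]
    by_cases hT : TakenBy ω n
    · obtain ⟨i, hi, -⟩ := id hT
      rw [ih hT (by omega), if_neg (hT.not_isTaken (k := k)), List.length_singleton]
      omega
    · rw [length_history_of_not_takenBy hT (by omega),
        if_pos ((takenBy_succ_iff (k := k)).1 h |>.resolve_left hT), List.length_nil, add_zero]

theorem history_getElem? {ω : Equiv.Perm (Fin N)} {k : Fin N} (hk : ¬ IsTaken ω k) {n : ℕ}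
    (hn : k + 1 ≤ n) : (history ω n)[(history ω k).length]? = some (seenRank ω k) := by
  have hprefix := history_prefix ω hn
  rw [history_succ, if_neg hk] at hprefix
  obtain ⟨t, ht⟩ := hprefix
  simp [← ht]

/-! ## Strategies that accept candidates only -/

/-- The strategy `σ` accepts only objects that are the best of those observed so far. -/
def AcceptsOnlyBest (σ : Strategy) : Prop :=
  ∀ L, σ L = true → L.getLast? = some 1

theorem AcceptsOnlyBest.isCandidate {σ : Strategy} (hσ : AcceptsOnlyBest σ)
    {ω : Equiv.Perm (Fin N)} {k : Fin N} (h : Wants σ ω k) : IsCandidate ω k := by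
  refine ⟨h.1, ?_⟩
  have hlast := hσ _ h.2
  rw [history_succ, if_neg h.1, List.getLast?_concat] at hlast
  exact Option.some.inj hlast

theorem winsAfter_iff {σ : Strategy} {ω : Equiv.Perm (Fin N)} {k : Fin N} :
    WinsAfter k σ ω ↔
      (Wants σ ω k ∧ (ω k : ℕ) = 0) ∨ (¬ Wants σ ω k ∧ WinsAfter (k + 1) σ ω) := by
  constructor
  · rintro ⟨i, hi, hw, hfirst, hbest⟩
    rcases Nat.lt_or_ge k i with hik | hik
    · exact Or.inr ⟨hfirst k (Nat.lt_succ_self _) hik, i, by omega, hw,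
        fun j hj => hfirst j (by omega), hbest⟩
    · obtain rfl : i = k := Fin.ext (by omega)
      exact Or.inl ⟨hw, hbest⟩
  · rintro (⟨hw, hbest⟩ | ⟨hw, i, hi, hwi, hfirst, hbest⟩)
    · exact ⟨k, Nat.lt_succ_self _, hw, fun j hj hjk => by omega, hbest⟩
    · refine ⟨i, by omega, hwi, fun j hj hji => ?_, hbest⟩
      rcases Nat.lt_or_ge k j with hkj | hkj
      · exact hfirst j (by omega) hji
      · obtain rfl : j = k := Fin.ext (by omega)
        exact hw

theorem winsAfter_congr {σ σ' : Strategy} {ω : Equiv.Perm (Fin N)} {n : ℕ}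
    (h : ∀ i : Fin N, n < (i : ℕ) + 1 → ¬ IsTaken ω i →
      σ (history ω (i + 1)) = σ' (history ω (i + 1))) :
    WinsAfter n σ ω ↔ WinsAfter n σ' ω := by
  have hwants : ∀ i : Fin N, n < (i : ℕ) + 1 → (Wants σ ω i ↔ Wants σ' ω i) :=
    fun i hi => and_congr_right fun hT => by rw [h i hi hT]
  refine exists_congr fun i => and_congr_right fun hi =>
    and_congr (hwants i hi) (and_congr_left fun _ => ?_)
  exact forall_congr' fun j => imp_congr_right fun hj => imp_congr_right fun _ =>
    not_congr (hwants j hj)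

/-- Follow `σ₁` if the `l`-th observed object was the best of those observed by then, and `σ₂`
otherwise; this object itself is accepted if and only if moreover `acc` holds. -/
def splice (acc : Prop) (l : ℕ) (σ₁ σ₂ : Strategy) : Strategy := fun L =>
  if L.length = l then decide (acc ∧ L[l - 1]? = some 1)
  else if L[l - 1]? = some 1 then σ₁ L else σ₂ L

theorem AcceptsOnlyBest.splice {acc : Prop} {l : ℕ} {σ₁ σ₂ : Strategy}
    (hσ₁ : AcceptsOnlyBest σ₁) (hσ₂ : AcceptsOnlyBest σ₂) :
    AcceptsOnlyBest (splice acc l σ₁ σ₂) := by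
  intro L hL
  unfold StackelbergSecretary.splice at hL
  split_ifs at hL with hl
  · rw [List.getLast?_eq_getElem?, hl]
    exact (of_decide_eq_true hL).2
  · exact hσ₁ L hL
  · exact hσ₂ L hL

/-- Whether object `k` is a candidate is recorded in the `l`-th entry of the history of Player 2
from moment `k + 1` on, and the history has length `l` at no later decision of his. Before `n*`
this holds for `l = k + 1`, and after `n*`, when `k` can be a candidate only if Player 1 has
already accepted an object, for `l = k`. -/
def IsObservationIndex (k : Fin N) (l : ℕ) : Prop :=
  ∀ ω : Equiv.Perm (Fin N),
    (∀ i, k < i → ¬ IsTaken ω i → l < (history ω (i + 1)).length) ∧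
    (IsCandidate ω k → (history ω (k + 1)).length = l) ∧
    ∀ n : ℕ, (k : ℕ) + 1 ≤ n → ((history ω n)[l - 1]? = some 1 ↔ IsCandidate ω k)

theorem history_getElem?_eq_one_iff {ω : Equiv.Perm (Fin N)} {k : Fin N} (hk : ¬ IsTaken ω k)
    {n : ℕ} (hn : k + 1 ≤ n) :
    (history ω n)[(history ω k).length]? = some 1 ↔ IsCandidate ω k := by
  rw [history_getElem? hk hn, Option.some_inj, IsCandidate, and_iff_right hk]

theorem isObservationIndex_succ {k : Fin N} (hk : (k : ℕ) + 1 < nStar N) :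
    IsObservationIndex k (k + 1) := by
  intro ω
  have hT : ¬ TakenBy ω (k + 1) := fun h => h.nStar_le.not_gt hk
  refine ⟨fun i hki hi => ?_, fun _ => length_history_of_not_takenBy hT k.2, fun n hn => ?_⟩
  · by_cases hTi : TakenBy ω (i + 1)
    · have := (takenBy_succ_iff.1 hTi |>.resolve_right hi).nStar_le
      rw [hTi.length_history i.2]
      omega
    · rw [length_history_of_not_takenBy hTi i.2]
      omega
  · rw [← history_getElem?_eq_one_iff (fun h => hT ⟨k, le_rfl, h⟩) hn,
      length_history_of_not_takenBy (fun h => hT (h.mono (Nat.le_succ _))) k.2.le,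
      Nat.add_sub_cancel]

theorem isObservationIndex_self {k : Fin N} (hk : nStar N < (k : ℕ) + 1) :
    IsObservationIndex k k := by
  intro ω
  refine ⟨fun i hki _ => ?_, fun hc => ?_, fun n hn => ?_⟩
  · by_cases hTi : TakenBy ω (i + 1)
    · rw [hTi.length_history i.2]
      omega
    · rw [length_history_of_not_takenBy hTi i.2]
      omega
  · by_cases hT : TakenBy ω k
    · exact (hT.mono (Nat.le_succ _)).length_history k.2
    · exact absurd hc (not_isCandidate_of_not_takenBy hk.le hT)
  · by_cases hT : TakenBy ω k
    · rw [← history_getElem?_eq_one_iff hT.not_isTaken hn, hT.length_history k.2.le]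
    · obtain ⟨j, hj⟩ : ∃ j : Fin N, (j : ℕ) + 1 = k :=
        ⟨⟨k - 1, by omega⟩, Nat.sub_add_cancel (by have := (nStar_spec k.pos).1; omega)⟩
      rw [← hj] at hT
      obtain ⟨hTj, hj'⟩ := not_or.1 (takenBy_succ_iff.not.1 hT)
      have hlen := length_history_of_not_takenBy hTj j.2.le
      refine iff_of_false (fun h => ?_) (not_isCandidate_of_not_takenBy hk.le (hj ▸ hT))
      rw [show (k : ℕ) - 1 = (history ω j).length by omega,
        history_getElem?_eq_one_iff hj' (by omega)] at h
      exact not_isCandidate_of_not_takenBy (by omega) hTj h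

theorem exists_splice (acc : Prop) (k : Fin N) {σ₁ σ₂ : Strategy} (hσ₁ : AcceptsOnlyBest σ₁)
    (hσ₂ : AcceptsOnlyBest σ₂) :
    ∃ σ, AcceptsOnlyBest σ ∧ ∀ ω : Equiv.Perm (Fin N),
      (IsCandidate ω k →
        (WinsAfter k σ ω ↔ if acc then (ω k : ℕ) = 0 else WinsAfter (k + 1) σ₁ ω)) ∧
      (¬ IsCandidate ω k → (WinsAfter k σ ω ↔ WinsAfter (k + 1) σ₂ ω)) := by
  have hpass : ∀ {σ : Strategy} {ω : Equiv.Perm (Fin N)}, ¬ Wants σ ω k →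
      (WinsAfter k σ ω ↔ WinsAfter (k + 1) σ ω) := fun hw => by
    rw [winsAfter_iff]
    simp only [hw, false_and, false_or, not_false_iff, true_and]
  by_cases hk : (k : ℕ) + 1 = nStar N
  · refine ⟨σ₂, hσ₂, fun ω => ⟨fun hc => absurd hc ?_, fun hc => hpass (hc ∘ hσ₂.isCandidate)⟩⟩
    refine not_isCandidate_of_not_takenBy hk.ge fun hT => ?_
    have := hT.nStar_le
    omega
  obtain ⟨l, hl⟩ : ∃ l, IsObservationIndex k l := (lt_or_gt_of_ne hk).elim
    (fun h => ⟨_, isObservationIndex_succ h⟩) (fun h => ⟨_, isObservationIndex_self h⟩)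
  refine ⟨splice acc l σ₁ σ₂, hσ₁.splice hσ₂, fun ω => ?_⟩
  obtain ⟨hlt, heq, hbest⟩ := hl ω
  refine ⟨fun hc => ?_, fun hc => ?_⟩
  · have hwants : Wants (splice acc l σ₁ σ₂) ω k ↔ acc := by
      rw [Wants, and_iff_right hc.1, splice, if_pos (heq hc), decide_eq_true_iff,
        and_iff_left ((hbest _ le_rfl).2 hc)]
    split_ifs with hacc
    · have hw := hwants.2 hacc
      rw [winsAfter_iff]
      simp only [hw, true_and, not_true_eq_false, false_and, or_false]
    · refine (hpass (hwants.not.2 hacc)).trans (winsAfter_congr fun i hi hT => ?_)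
      rw [splice, if_neg (hlt i (by omega) hT).ne', if_pos ((hbest _ (by omega)).2 hc)]
  · refine (hpass (hc ∘ (hσ₁.splice hσ₂).isCandidate)).trans (winsAfter_congr fun i hi hT => ?_)
    rw [splice, if_neg (hlt i (by omega) hT).ne', if_neg (hc ∘ (hbest _ (by omega)).1)]

/-! ## One step of the game -/

section Transitions

/-- Player 1 has accepted none of the first `n` objects. -/
def freeEvent (N n : ℕ) : Set (Equiv.Perm (Fin N)) := {ω | ¬ TakenBy ω n}

/-- Player 1 has accepted one of the first `n` objects, and it is not the best of them. -/
def beatenEvent (N n : ℕ) : Set (Equiv.Perm (Fin N)) := {ω | TakenBy ω n ∧ ¬ TakenTop ω n}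

/-- Player 1 has accepted one of the first `n` objects, and it is the best of them. -/
def topEvent (N n : ℕ) : Set (Equiv.Perm (Fin N)) := {ω | TakenTop ω n}

/-- Object `k` is a candidate. -/
def candidateEvent (k : Fin N) : Set (Equiv.Perm (Fin N)) := {ω | IsCandidate ω k}

theorem determinedBy_takenBy (n : ℕ) : DeterminedBy n {ω : Equiv.Perm (Fin N) | TakenBy ω n} :=
  determinedBy_setOf fun _ _ hs => takenBy_congr hs le_rfl

theorem determinedBy_freeEvent (n : ℕ) : DeterminedBy n (freeEvent N n) :=
  determinedBy_setOf fun _ _ hs => not_congr (takenBy_congr hs le_rfl)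

theorem determinedBy_beatenEvent (n : ℕ) : DeterminedBy n (beatenEvent N n) :=
  determinedBy_setOf fun _ _ hs =>
    and_congr (takenBy_congr hs le_rfl) (not_congr (takenTop_congr hs le_rfl))

theorem determinedBy_topEvent (n : ℕ) : DeterminedBy n (topEvent N n) :=
  determinedBy_setOf fun _ _ hs => takenTop_congr hs le_rfl

theorem determinedBy_candidateEvent (k : Fin N) : DeterminedBy (k + 1) (candidateEvent k) :=
  determinedBy_setOf fun _ _ hs => isCandidate_congr hs (Nat.lt_succ_self _)

theorem realCard_inter_takenBy (E : Set (Equiv.Perm (Fin N))) (n : ℕ) :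
    realCard (E ∩ {ω | TakenBy ω n})
      = realCard (E ∩ beatenEvent N n) + realCard (E ∩ topEvent N n) := by
  rw [← realCard_inter_add_diff _ (topEvent N n), add_comm]
  congr 2
  · ext ω
    exact and_assoc
  · ext ω
    exact ⟨fun h => ⟨h.1.1, h.2⟩, fun h => ⟨⟨h.1, h.2.takenBy⟩, h.2⟩⟩

variable {k : Fin N} {E : Set (Equiv.Perm (Fin N))}

theorem inter_candidateEvent_inter_freeEvent (hk : nStar N ≤ k + 1) :
    (E ∩ candidateEvent k) ∩ freeEvent N (k + 1) = ∅ :=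
  Set.eq_empty_of_forall_notMem fun _ ⟨⟨_, hc⟩, hfree⟩ =>
    not_isCandidate_of_not_takenBy hk (fun h => hfree (h.mono (Nat.le_succ _))) hc

theorem realCard_candidateEvent_beatenEvent (hk : nStar N ≤ k + 1) (hE : DeterminedBy k E) :
    realCard ((E ∩ candidateEvent k) ∩ beatenEvent N (k + 1))
      = (realCard (E ∩ beatenEvent N k) + realCard (E ∩ topEvent N k)) / ((k : ℕ) + 1) := by
  rw [← realCard_inter_takenBy,
    ← realCard_relRank (hE.inter (determinedBy_takenBy _)) le_rfl (by omega)]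
  congr 1
  ext ω
  have := @takenTop_succ_iff N ω k
  have := @TakenBy.mono N ω k (k + 1) (Nat.le_succ k)
  have := @TakenBy.isCandidate_iff N ω k
  have := @TakenTop.isCandidate_iff N ω k
  have := not_isCandidate_of_not_takenBy (ω := ω) hk
  simp only [candidateEvent, beatenEvent, Set.mem_inter_iff, Set.mem_ofPred_eq]
  grind

theorem realCard_candidateEvent_topEvent (hk₁ : 1 ≤ (k : ℕ)) (hk : nStar N ≤ k + 1)
    (hE : DeterminedBy k E) :
    realCard ((E ∩ candidateEvent k) ∩ topEvent N (k + 1))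
      = realCard (E ∩ topEvent N k) / ((k : ℕ) + 1) := by
  rw [← realCard_relRank (hE.inter (determinedBy_topEvent _)) (r := 2) (by omega) (by omega)]
  congr 1
  ext ω
  have := @takenTop_succ_iff N ω k
  have := @TakenTop.takenBy N ω k
  have := @TakenTop.isCandidate_iff N ω k
  have := not_isCandidate_of_not_takenBy (ω := ω) hk
  simp only [candidateEvent, topEvent, Set.mem_inter_iff, Set.mem_ofPred_eq]
  grind

theorem realCard_diff_candidateEvent_freeEvent (hk : nStar N ≤ k + 1) (hE : DeterminedBy k E) :
    realCard ((E \ candidateEvent k) ∩ freeEvent N (k + 1))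
      = k * realCard (E ∩ freeEvent N k) / ((k : ℕ) + 1) := by
  rw [← realCard_diff_relRank (hE.inter (determinedBy_freeEvent _))]
  congr 1
  ext ω
  have := takenBy_succ_iff_relRank (ω := ω) hk
  have := @TakenBy.mono N ω k (k + 1) (Nat.le_succ k)
  have := not_isCandidate_of_not_takenBy (ω := ω) hk
  simp only [candidateEvent, freeEvent, Set.mem_inter_iff, Set.mem_sdiff, Set.mem_ofPred_eq]
  grind

theorem realCard_diff_candidateEvent_beatenEvent (hk : nStar N ≤ k + 1)
    (hE : DeterminedBy k E) :
    realCard ((E \ candidateEvent k) ∩ beatenEvent N (k + 1))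
      = k * realCard (E ∩ beatenEvent N k) / ((k : ℕ) + 1) := by
  rw [← realCard_diff_relRank (hE.inter (determinedBy_beatenEvent _))]
  congr 1
  ext ω
  have := @takenTop_succ_iff N ω k
  have := @TakenBy.mono N ω k (k + 1) (Nat.le_succ k)
  have := @TakenBy.isCandidate_iff N ω k
  have := @TakenTop.isCandidate_iff N ω k
  have := takenBy_succ_iff_relRank (ω := ω) hk
  have := takenTop_succ_iff_relRank (ω := ω) hk
  simp only [candidateEvent, beatenEvent, Set.mem_inter_iff, Set.mem_sdiff, Set.mem_ofPred_eq]
  grind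

theorem realCard_diff_candidateEvent_topEvent (hk₁ : 1 ≤ (k : ℕ)) (hk : nStar N ≤ k + 1)
    (hE : DeterminedBy k E) :
    realCard ((E \ candidateEvent k) ∩ topEvent N (k + 1))
      = ((k - 1) * realCard (E ∩ topEvent N k) + realCard (E ∩ freeEvent N k))
        / ((k : ℕ) + 1) := by
  rw [add_div, ← realCard_diff_relRank_diff_relRank hk₁ (hE.inter (determinedBy_topEvent _)),
    ← realCard_relRank (hE.inter (determinedBy_freeEvent _)) le_rfl (by omega),
    ← realCard_inter_add_diff _ {ω | TakenBy ω k}]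
  congr 2 <;>
  · ext ω
    have := @takenTop_succ_iff N ω k
    have := @TakenTop.takenBy N ω k
    have := @TakenTop.isCandidate_iff N ω k
    have := takenTop_succ_iff_relRank (ω := ω) hk
    have := not_isCandidate_of_not_takenBy (ω := ω) hk
    simp only [candidateEvent, topEvent, freeEvent, Set.mem_inter_iff, Set.mem_sdiff,
      Set.mem_ofPred_eq]
    grind

end Transitions

/-! ## Achievable rewards -/

/-- Some strategy that accepts candidates only obtains the best object after moment `n` in at
least `w` of the realizations in `E`. -/
def Achievable (n : ℕ) (E : Set (Equiv.Perm (Fin N))) (w : ℝ) : Prop :=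
  ∃ σ, AcceptsOnlyBest σ ∧ w ≤ realCard (E ∩ {ω | WinsAfter n σ ω})

variable {n : ℕ} {E : Set (Equiv.Perm (Fin N))} {w : ℝ}

theorem Achievable.mono {w' : ℝ} (h : Achievable n E w) (hw : w' ≤ w) : Achievable n E w' :=
  h.imp fun _ h => ⟨h.1, hw.trans h.2⟩

theorem achievable_zero : Achievable n E 0 :=
  ⟨fun _ => false, fun _ h => absurd h Bool.false_ne_true, realCard_nonneg _⟩

theorem Achievable.step {k : Fin N} {a w₁ w₂ : ℝ}
    (h₁ : Achievable (k + 1) (E ∩ candidateEvent k) w₁)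
    (h₂ : Achievable (k + 1) (E \ candidateEvent k) w₂)
    (ha : a ≤ realCard ((E ∩ candidateEvent k) ∩ {ω | (ω k : ℕ) = 0})) :
    Achievable k E (w₂ + max a w₁) := by
  obtain ⟨σ₁, hσ₁, hw₁⟩ := h₁
  obtain ⟨σ₂, hσ₂, hw₂⟩ := h₂
  obtain ⟨σ, hσ, hwin⟩ := exists_splice (w₁ ≤ a) k hσ₁ hσ₂
  refine ⟨σ, hσ, ?_⟩
  have hreject : (E ∩ {ω | WinsAfter k σ ω}) \ candidateEvent k
      = (E \ candidateEvent k) ∩ {ω | WinsAfter (k + 1) σ₂ ω} := by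
    ext ω
    exact and_right_comm.trans (and_congr_right fun h => (hwin ω).2 h.2)
  have haccept : max a w₁ ≤ realCard ((E ∩ {ω | WinsAfter k σ ω}) ∩ candidateEvent k) := by
    have hset : ∀ {W : Set (Equiv.Perm (Fin N))},
        (∀ ω, IsCandidate ω k → (WinsAfter k σ ω ↔ ω ∈ W)) →
          (E ∩ {ω | WinsAfter k σ ω}) ∩ candidateEvent k = (E ∩ candidateEvent k) ∩ W := by
      refine fun hW => Set.ext fun ω => ?_
      rw [Set.inter_right_comm]
      exact and_congr_right fun h => hW ω h.2
    by_cases hacc : w₁ ≤ a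
    · rw [max_eq_left hacc, hset fun ω hc => ((hwin ω).1 hc).trans (by rw [if_pos hacc]; rfl)]
      exact ha
    · rw [max_eq_right (not_le.1 hacc).le,
        hset fun ω hc => ((hwin ω).1 hc).trans (by rw [if_neg hacc]; rfl)]
      exact hw₁
  rw [← realCard_inter_add_diff _ (candidateEvent k), hreject, add_comm]
  exact add_le_add haccept hw₂

theorem Achievable.le_optimalReward (hE : E.Nonempty) (h : Achievable n E (w * realCard E)) :
    w ≤ optimalReward n E := by
  have hpos := realCard_pos hE
  obtain ⟨σ, -, hσ⟩ := h
  have hbdd : BddAbove (Set.range fun σ : Strategy => condProb {ω | WinsAfter n σ ω} E) := by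
    refine ⟨1, ?_⟩
    rintro _ ⟨σ, rfl⟩
    exact div_le_one_of_le₀ (realCard_mono Set.inter_subset_right) hpos.le
  refine le_trans ?_ (le_ciSup hbdd σ)
  rw [Set.inter_comm] at hσ
  exact (le_div_iff₀ hpos).2 hσ

theorem isCandidate_of_eq_zero {ω : Equiv.Perm (Fin N)} {k : Fin N} (hk : ¬ IsTaken ω k)
    (h : (ω k : ℕ) = 0) : IsCandidate ω k :=
  ⟨hk, (seenRank_eq_one_iff hk).2 fun _ _ _ => Fin.le_def.2 (by omega)⟩

theorem div_le_realCard_candidateEvent_best {k : Fin N} {F : Set (Equiv.Perm (Fin N))}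
    (hF : DeterminedBy k F) (hFE : F ⊆ E) (hFT : ∀ ω ∈ F, ¬ IsTaken ω k) :
    realCard F / N ≤ realCard ((E ∩ candidateEvent k) ∩ {ω | (ω k : ℕ) = 0}) := by
  rw [← realCard_best_of_determinedBy hF]
  exact realCard_mono fun ω ⟨hω, hbest⟩ =>
    ⟨⟨hFE hω, isCandidate_of_eq_zero (hFT ω hω) hbest⟩, hbest⟩

theorem achievable_gameValue (hn₁ : 1 ≤ n) (hn : nStar N ≤ n + 1) (hE : DeterminedBy n E) :
    Achievable n E (gameValue N n (realCard (E ∩ freeEvent N n))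
      (realCard (E ∩ beatenEvent N n)) (realCard (E ∩ topEvent N n))) := by
  induction n using downward_induction (N := N) generalizing E with
  | hbase n h =>
    rw [gameValue_of_le h]
    exact achievable_zero
  | hstep n h ih =>
    let k : Fin N := ⟨n, h⟩
    have hcand := determinedBy_candidateEvent k
    have hE' := hE.mono (Nat.le_succ n)
    have hreject := ih (Nat.le_add_left 1 n) (by omega) (hE'.inter hcand)
    have hpass := ih (Nat.le_add_left 1 n) (by omega) (hE'.diff hcand)
    rw [inter_candidateEvent_inter_freeEvent (k := k) hn, realCard_empty,
      realCard_candidateEvent_beatenEvent (k := k) hn hE,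
      realCard_candidateEvent_topEvent (k := k) hn₁ hn hE] at hreject
    rw [realCard_diff_candidateEvent_freeEvent (k := k) hn hE,
      realCard_diff_candidateEvent_beatenEvent (k := k) hn hE,
      realCard_diff_candidateEvent_topEvent (k := k) hn₁ hn hE] at hpass
    rw [gameValue_of_lt h]
    refine Achievable.step (k := k) hreject hpass ?_
    rw [← realCard_inter_takenBy]
    exact div_le_realCard_candidateEvent_best (hE.inter (determinedBy_takenBy n))
      Set.inter_subset_left fun ω hω => TakenBy.not_isTaken (k := k) hω.2

/-! ## The reward when Player 1 has accepted no object -/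

theorem nextBestProb_succ (n : ℕ) : nextBestProb n (n + 1) = 1 / (n + 1) := by
  rw [nextBestProb]
  split_ifs with hn hn'
  · simp [hn]
  · omega
  · have : (n : ℝ) ≠ 0 := by exact_mod_cast hn
    push_cast
    rw [add_sub_cancel_right]
    field_simp

theorem nextBestProb_eq_mul {n k : ℕ} (hk : n + 1 < k) :
    nextBestProb n k = n / (n + 1) * nextBestProb (n + 1) k := by
  rw [nextBestProb, nextBestProb, if_neg (by omega : n + 1 ≠ 0)]
  split_ifs with hn hk'
  · omega
  · simp [hn]
  · push_cast
    field_simp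

theorem vApproxBefore_of_lt {n : ℕ} (hN : 2 ≤ nStar N) (hn : n < nStar N) :
    vApproxBefore N n = (∑ k ∈ Finset.Ico (n + 1) (nStar N),
      nextBestProb n k * max ((k : ℝ) / N) (vApproxBefore N k))
    + vApproxBefore N (nStar N - 1) * ((n : ℝ) / ((nStar N : ℝ) - 1)) := by
  rcases (Nat.succ_le_of_lt hn).eq_or_lt with h | h
  · have hpos : (2 : ℝ) ≤ nStar N := by exact_mod_cast hN
    have hcast : (n : ℝ) = nStar N - 1 := by rw [← h]; push_cast; ring
    rw [Finset.Ico_eq_empty_of_le h.ge, Finset.sum_empty, zero_add, hcast,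
      div_self (by linarith), mul_one, show nStar N - 1 = n by omega]
  · conv_lhs => rw [vApproxBefore, if_neg h.not_ge]
    rw [Finset.sum_attach (Finset.Ico (n + 1) (nStar N))
      (fun k => nextBestProb n k * max ((k : ℝ) / N) (vApproxBefore N k))]

theorem vApproxBefore_eq_step {n : ℕ} (hn : n + 1 < nStar N) :
    vApproxBefore N n = n / (n + 1) * vApproxBefore N (n + 1)
      + 1 / (n + 1) * max (((n : ℝ) + 1) / N) (vApproxBefore N (n + 1)) := by
  have hlater : ∑ k ∈ Finset.Ico (n + 1 + 1) (nStar N),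
      nextBestProb n k * max ((k : ℝ) / N) (vApproxBefore N k)
      = n / (n + 1) * ∑ k ∈ Finset.Ico (n + 1 + 1) (nStar N),
      nextBestProb (n + 1) k * max ((k : ℝ) / N) (vApproxBefore N k) := by
    rw [Finset.mul_sum]
    refine Finset.sum_congr rfl fun k hk => ?_
    rw [nextBestProb_eq_mul (Finset.mem_Ico.1 hk).1, mul_assoc]
  have hnone : vApproxBefore N (nStar N - 1) * ((n : ℝ) / ((nStar N : ℝ) - 1))
      = n / (n + 1) * (vApproxBefore N (nStar N - 1)
        * (((n + 1 : ℕ) : ℝ) / ((nStar N : ℝ) - 1))) := by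
    push_cast
    field_simp
  have hnext := vApproxBefore_of_lt (N := N) (n := n + 1) (by omega) hn
  rw [vApproxBefore_of_lt (by omega) (by omega), Finset.sum_eq_sum_Ico_succ_bot hn,
    nextBestProb_succ, hlater, hnone]
  push_cast at hnext ⊢
  linear_combination (-(n : ℝ) / (n + 1)) * hnext

theorem vApproxBefore_le_gameValue (hn₁ : 1 ≤ n) (hn : nStar N ≤ n + 1) :
    vApproxBefore N n ≤ gameValue N n 1 0 0 := by
  rw [vApproxBefore, if_pos hn]
  exact sum_vApprox_le_gameValue hn₁

theorem achievable_vApproxBefore_of_nStar_le (hn₁ : 1 ≤ n) (hn : nStar N ≤ n + 1)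
    (hE : DeterminedBy n E) (hfree : E ⊆ freeEvent N n) :
    Achievable n E (vApproxBefore N n * realCard E) := by
  have hgame := achievable_gameValue hn₁ hn hE
  have hbeaten : E ∩ beatenEvent N n = ∅ :=
    Set.eq_empty_of_forall_notMem fun _ h => hfree h.1 h.2.1
  have htop : E ∩ topEvent N n = ∅ :=
    Set.eq_empty_of_forall_notMem fun _ h => hfree h.1 h.2.takenBy
  have hscale := gameValue_smul N n (realCard_nonneg E) 1 0 0
  rw [mul_one, mul_zero] at hscale
  rw [Set.inter_eq_left.2 hfree, hbeaten, htop, realCard_empty, hscale] at hgame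
  refine hgame.mono ?_
  rw [mul_comm]
  exact mul_le_mul_of_nonneg_left (vApproxBefore_le_gameValue hn₁ hn) (realCard_nonneg E)

theorem realCard_candidateEvent_of_lt_nStar {k : Fin N} (hk : k + 1 < nStar N)
    (hE : DeterminedBy k E) :
    realCard (E ∩ candidateEvent k) = realCard E / ((k : ℕ) + 1) ∧
      realCard (E \ candidateEvent k) = k * realCard E / ((k : ℕ) + 1) := by
  have hcand : candidateEvent k = {ω | relRank ω k = 1} := Set.ext fun ω =>
    isCandidate_iff_of_not_takenBy fun h => h.nStar_le.not_gt hk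
  rw [hcand]
  exact ⟨realCard_relRank hE le_rfl (by omega), realCard_diff_relRank hE⟩

theorem achievable_vApproxBefore (hN : 3 ≤ N) (hE : DeterminedBy n E)
    (hfree : E ⊆ freeEvent N n) : Achievable n E (vApproxBefore N n * realCard E) := by
  have hle := nStar_le (N := N) (by omega)
  have htwo := two_le_nStar hN
  induction n using downward_induction (N := nStar N - 1) generalizing E with
  | hbase n h => exact achievable_vApproxBefore_of_nStar_le (by omega) (by omega) hE hfree
  | hstep n h ih =>
    let k : Fin N := ⟨n, by omega⟩
    have hcand := determinedBy_candidateEvent k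
    have hE' := hE.mono (Nat.le_succ n)
    have hlt : n + 1 < nStar N := by omega
    have hfree' : ∀ ω : Equiv.Perm (Fin N), ¬ TakenBy ω (n + 1) :=
      fun _ hT => hT.nStar_le.not_gt hlt
    have hreject := ih (hE'.inter hcand) fun ω _ => hfree' ω
    have hpass := ih (hE'.diff hcand) fun ω _ => hfree' ω
    obtain ⟨hcard, hcard'⟩ := realCard_candidateEvent_of_lt_nStar (k := k) hlt hE
    rw [hcard] at hreject
    rw [hcard'] at hpass
    refine (Achievable.step (k := k) hreject hpass (div_le_realCard_candidateEvent_best hE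
      subset_rfl fun ω _ hT => hfree' ω ⟨k, le_rfl, hT⟩)).mono (le_of_eq ?_)
    rw [vApproxBefore_eq_step hlt]
    have hmax := max_mul_of_nonneg (((n : ℝ) + 1) / N) (vApproxBefore N (n + 1))
      (div_nonneg (realCard_nonneg E) (by positivity : (0 : ℝ) ≤ (n : ℝ) + 1))
    have hbest : ((n : ℝ) + 1) / N * (realCard E / (n + 1)) = realCard E / N := by field_simp
    rw [hbest] at hmax
    rw [← hmax]
    ring

/-! ## Candidates and the odds that the object of Player 1 is not the best so far -/

theorem candidateCount_succ_le (ω : Equiv.Perm (Fin N)) (k : Fin N) :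
    candidateCount ω (k + 1) ≤ candidateCount ω k + if IsCandidate ω k then 1 else 0 := by
  have hsub : Finset.univ.filter
      (fun i : Fin N => nStar N < (i : ℕ) + 1 ∧ (i : ℕ) + 1 ≤ k + 1 ∧ IsCandidate ω i)
      ⊆ Finset.univ.filter
        (fun i : Fin N => nStar N < (i : ℕ) + 1 ∧ (i : ℕ) + 1 ≤ k ∧ IsCandidate ω i)
        ∪ if IsCandidate ω k then {k} else ∅ := by
    intro i hi
    simp only [Finset.mem_filter, Finset.mem_univ, true_and, Finset.mem_union] at hi ⊢
    obtain ⟨hn, hik, hc⟩ := hi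
    rcases Nat.lt_or_ge i k with hik | hik
    · exact Or.inl ⟨hn, hik, hc⟩
    · obtain rfl : i = k := Fin.ext (by omega)
      simp [hc]
  refine (Finset.card_le_card hsub).trans ((Finset.card_union_le _ _).trans ?_)
  refine Nat.add_le_add_left ?_ _
  split_ifs <;> simp

theorem exists_isCandidate {ω : Equiv.Perm (Fin N)} (h : candidateCount ω n ≠ 0) :
    ∃ i : Fin N, nStar N < i + 1 ∧ (i : ℕ) + 1 ≤ n ∧ IsCandidate ω i := by
  obtain ⟨i, hi⟩ := Finset.card_ne_zero.1 h
  exact ⟨i, (Finset.mem_filter.1 hi).2⟩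

theorem IsCandidate.takenBy {ω : Equiv.Perm (Fin N)} {k : Fin N} (h : IsCandidate ω k)
    (hk : nStar N ≤ k + 1) : TakenBy ω k :=
  not_imp_not.1 (not_isCandidate_of_not_takenBy hk) h

theorem takenBy_of_candidateCount_succ_ne_zero {ω : Equiv.Perm (Fin N)}
    (h : candidateCount ω (n + 1) ≠ 0) : TakenBy ω n := by
  obtain ⟨i, hni, hin, hi⟩ := exists_isCandidate h
  exact (hi.takenBy hni.le).mono (by omega)

theorem seenRank_le_of_takenBy {ω : Equiv.Perm (Fin N)} {k : Fin N} (h : TakenBy ω k) :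
    seenRank ω k ≤ k := by
  obtain ⟨t, ht, htaken⟩ := h
  have hssub : (Finset.univ.filter fun j : Fin N => j ≤ k ∧ ¬ IsTaken ω j ∧ ω j ≤ ω k)
      ⊂ Finset.Iic k := by
    refine (Finset.ssubset_iff_of_subset fun j hj =>
      Finset.mem_Iic.2 (Finset.mem_filter.1 hj).2.1).2 ⟨t, ?_, ?_⟩
    · exact Finset.mem_Iic.2 (Fin.le_def.2 (by omega))
    · simp [htaken]
  simpa [seenRank, Nat.lt_succ_iff] using Finset.card_lt_card hssub

theorem relRank_eq_card_add_one (ω : Equiv.Perm (Fin N)) (k : Fin N) :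
    relRank ω k = (Finset.univ.filter fun j : Fin N => j < k ∧ ω j ≤ ω k).card + 1 := by
  rw [relRank, ← Finset.card_insert_of_notMem (a := k) (by simp)]
  congr 1
  ext j
  simp only [Finset.mem_filter, Finset.mem_univ, true_and, Finset.mem_insert, le_iff_lt_or_eq]
  grind

/-- The rank, among the objects before `k`, of the object that Player 1 has accepted. -/
def takenRank (k : Fin N) (ω : Equiv.Perm (Fin N)) : ℕ :=
  (Finset.univ.filter fun j : Fin N => j < k ∧ ∃ t, t < k ∧ IsTaken ω t ∧ ω j ≤ ω t).card

theorem takenRank_congr {k : Fin N} {ω ω' : Equiv.Perm (Fin N)} (h : SameOrder k ω ω') :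
    takenRank k ω = takenRank k ω' := by
  rw [takenRank, takenRank]
  congr 1
  refine Finset.filter_congr fun j _ => and_congr_right fun hj => exists_congr fun t =>
    and_congr_right fun ht => ?_
  rw [isTaken_congr h ht, h j t hj ht]

theorem relRank_le_takenRank_iff {k t : Fin N} {ω : Equiv.Perm (Fin N)} (htk : t < k)
    (ht : IsTaken ω t) : relRank ω k ≤ takenRank k ω ↔ ω k < ω t := by
  have htaken : takenRank k ω = (Finset.univ.filter fun j => j < k ∧ ω j ≤ ω t).card := by
    rw [takenRank]
    congr 1
    refine Finset.filter_congr fun j _ => and_congr_right fun _ => ?_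
    exact ⟨fun ⟨i, _, hi, hle⟩ => hi.eq ht ▸ hle, fun h => ⟨t, htk, ht, h⟩⟩
  rw [relRank_eq_card_add_one, htaken, Nat.succ_le_iff]
  constructor
  · contrapose!
    exact fun hle => Finset.card_le_card (Finset.monotone_filter_right _ fun j _ hj =>
      ⟨hj.1, hj.2.trans hle⟩)
  · intro hlt
    refine Finset.card_lt_card ((Finset.ssubset_iff_of_subset ?_).2 ⟨t, ?_, ?_⟩)
    · exact Finset.monotone_filter_right _ fun j _ hj => ⟨hj.1, hj.2.trans hlt.le⟩
    · simp [htk]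
    · simp [hlt]

theorem seenRank_eq_of_relRank_eq {k : Fin N} {ω : Equiv.Perm (Fin N)} (h : TakenBy ω k) {s : ℕ}
    (hr : relRank ω k = if s ≤ takenRank k ω then s else s + 1) : seenRank ω k = s := by
  obtain ⟨t, ht, htaken⟩ := h
  have htk : t < k := Fin.lt_def.2 (by omega)
  have hsum := relRank_eq_seenRank_add htaken htk.le
  have hiff := relRank_le_takenRank_iff htk htaken
  rw [← not_le] at hiff
  split_ifs at hr hsum <;> grind

/-- The realizations in which Player 2 has the same history at moment `n` as in `ω`. -/
def historyClass (ω : Equiv.Perm (Fin N)) (n : ℕ) : Set (Equiv.Perm (Fin N)) :=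
  {ω' | history ω' n = history ω n}

theorem determinedBy_historyClass (ω : Equiv.Perm (Fin N)) (n : ℕ) :
    DeterminedBy n (historyClass ω n) :=
  determinedBy_setOf fun _ _ hs => by rw [history_congr hs le_rfl]

theorem takenBy_of_mem_historyClass {ω ω' : Equiv.Perm (Fin N)} (hn : n ≤ N)
    (h : TakenBy ω n) (hω' : ω' ∈ historyClass ω n) : TakenBy ω' n := by
  by_contra hT
  have hlen := congrArg List.length (show history ω' n = history ω n from hω')
  rw [h.length_history hn, length_history_of_not_takenBy hT hn] at hlen
  obtain ⟨i, hi, -⟩ := h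
  omega

theorem isCandidate_of_mem_historyClass {ω ω' : Equiv.Perm (Fin N)} {k : Fin N}
    (hk : nStar N < k + 1) (hn : k + 1 ≤ n) (h : IsCandidate ω k)
    (hω' : ω' ∈ historyClass ω n) : IsCandidate ω' k := by
  rw [← (isObservationIndex_self hk _).2.2 n hn] at h ⊢
  rwa [show history ω' n = history ω n from hω']

theorem historyClass_succ {ω : Equiv.Perm (Fin N)} {k : Fin N}
    (hc : candidateCount ω (k + 1) ≠ 0) :
    historyClass ω (k + 1) = historyClass ω k ∩ {ω' | seenRank ω' k = seenRank ω k} := by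
  have hT : TakenBy ω k := takenBy_of_candidateCount_succ_ne_zero hc
  have hiff : ∀ {ω' : Equiv.Perm (Fin N)}, TakenBy ω' k → (ω' ∈ historyClass ω (k + 1) ↔
      ω' ∈ historyClass ω k ∩ {ω' | seenRank ω' k = seenRank ω k}) := fun {ω'} hT' => by
    change history ω' (k + 1) = history ω (k + 1) ↔ _
    rw [history_succ, history_succ, if_neg hT.not_isTaken, if_neg hT'.not_isTaken]
    exact ⟨fun h => (List.append_inj' h rfl).imp_right fun h => by simpa using h,
      fun ⟨h, hs⟩ => congrArg₂ _ h (congrArg (fun r => [r]) hs)⟩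
  obtain ⟨i, hni, hik, hi⟩ := exists_isCandidate hc
  ext ω'
  refine ⟨fun h => (hiff ?_).1 h,
    fun h => (hiff (takenBy_of_mem_historyClass k.2.le hT h.1)).2 h⟩
  exact ((isCandidate_of_mem_historyClass hni hik hi h).takenBy hni.le).mono (by omega)

section SeenRank

variable {k : Fin N} {s : ℕ}

theorem realCard_seenRank_topEvent_le (hE : DeterminedBy k E) (hT : ∀ ω ∈ E, TakenBy ω k)
    (hsk : s ≤ k) :
    realCard ((E ∩ {ω | seenRank ω k = s}) ∩ topEvent N (k + 1))
      ≤ realCard (E ∩ topEvent N k) / ((k : ℕ) + 1) := by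
  rw [← realCard_relRank (hE.inter (determinedBy_topEvent k)) (r := s + 1) (by omega) (by omega)]
  refine realCard_mono fun ω ⟨⟨hω, hs⟩, htop⟩ =>
    ⟨⟨hω, ((takenTop_succ_iff (hT ω hω)).1 htop).1⟩, ?_⟩
  obtain ⟨t, ht, htaken, hbest⟩ := htop
  have hr := relRank_eq_seenRank_add htaken (Fin.le_def.2 (Nat.succ_le_succ_iff.1 ht))
  rw [if_pos (hbest k (Nat.lt_succ_self _)), hs] at hr
  exact hr

theorem le_realCard_seenRank_beatenEvent (hE : DeterminedBy k E) (hs : 1 ≤ s) (hsk : s ≤ k) :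
    realCard (E ∩ beatenEvent N k) / ((k : ℕ) + 1)
      ≤ realCard ((E ∩ {ω | seenRank ω k = s}) ∩ beatenEvent N (k + 1)) := by
  rw [← realCard_relRank_eq (hE.inter (determinedBy_beatenEvent k))
    (r := fun ω => if s ≤ takenRank k ω then s else s + 1) (fun ω => by split_ifs <;> omega)
    (fun ω => by split_ifs <;> omega) fun ω ω' h => by rw [takenRank_congr h]]
  refine realCard_mono fun ω ⟨⟨hω, hT, htop⟩, hr⟩ =>
    ⟨⟨hω, seenRank_eq_of_relRank_eq hT hr⟩, hT.mono (Nat.le_succ _), fun h => htop ?_⟩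
  exact ((takenTop_succ_iff hT).1 h).1

end SeenRank

theorem inter_seenRank_eq_one {k : Fin N} (hT : ∀ ω ∈ E, TakenBy ω k) :
    E ∩ {ω | seenRank ω k = 1} = E ∩ candidateEvent k :=
  Set.ext fun ω => and_congr_right fun hω =>
    ⟨fun hs => ⟨(hT ω hω).not_isTaken, hs⟩, fun h => h.2⟩

theorem candidateCount_mul_realCard_le (hn : n ≤ N) {ω : Equiv.Perm (Fin N)}
    (hT : TakenBy ω n) :
    candidateCount ω n * realCard (historyClass ω n ∩ topEvent N n)
      ≤ realCard (historyClass ω n ∩ beatenEvent N n) := by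
  induction n with
  | zero => exact absurd hT.one_le (by omega)
  | succ n ih =>
    obtain ⟨k, rfl⟩ : ∃ k : Fin N, (k : ℕ) = n := ⟨⟨n, hn⟩, rfl⟩
    by_cases hc : candidateCount ω (k + 1) = 0
    · rw [hc, Nat.cast_zero, zero_mul]
      exact realCard_nonneg _
    have hTk : TakenBy ω k := takenBy_of_candidateCount_succ_ne_zero hc
    have hk : nStar N ≤ k := hTk.nStar_le
    have hk₁ : 1 ≤ (k : ℕ) := hTk.one_le
    have hE := determinedBy_historyClass ω k
    have hET : ∀ ω' ∈ historyClass ω k, TakenBy ω' k :=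
      fun _ => takenBy_of_mem_historyClass k.2.le hTk
    have hcount : (candidateCount ω (k + 1) : ℝ)
        ≤ candidateCount ω k + if IsCandidate ω k then 1 else 0 := by
      exact_mod_cast candidateCount_succ_le ω k
    have hih := ih k.2.le hTk
    rw [historyClass_succ hc]
    by_cases hcand : IsCandidate ω k
    · rw [if_pos hcand] at hcount
      rw [hcand.2, inter_seenRank_eq_one hET, realCard_candidateEvent_topEvent hk₁ (by omega) hE,
        realCard_candidateEvent_beatenEvent (by omega) hE, ← mul_div_assoc]
      gcongr
      nlinarith [realCard_nonneg (historyClass ω k ∩ topEvent N k)]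
    · rw [if_neg hcand, add_zero] at hcount
      have hsk := seenRank_le_of_takenBy hTk
      refine (mul_le_mul hcount (realCard_seenRank_topEvent_le hE hET hsk) (realCard_nonneg _)
        (Nat.cast_nonneg _)).trans (le_trans ?_
          (le_realCard_seenRank_beatenEvent hE (seenRank_pos hTk.not_isTaken) hsk))
      rw [← mul_div_assoc]
      gcongr

/-! ## The lower bounds -/

theorem achievable_vApprox {m : ℕ} (hn₂ : 2 ≤ n) (hn : nStar N ≤ n + 1) (hE : DeterminedBy n E)
    (hT : ∀ ω ∈ E, TakenBy ω n)
    (hm : m * realCard (E ∩ topEvent N n) ≤ realCard (E ∩ beatenEvent N n)) :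
    Achievable n E (vApprox N n m * realCard E) := by
  have hfree : E ∩ freeEvent N n = ∅ := Set.eq_empty_of_forall_notMem fun ω h => h.2 (hT ω h.1)
  have hsplit := realCard_inter_takenBy E n
  rw [(Set.inter_eq_left (t := {ω | TakenBy ω n})).2 hT] at hsplit
  have hgame := achievable_gameValue (one_le_two.trans hn₂) hn hE
  rw [hfree, realCard_empty] at hgame
  refine hgame.mono ?_
  rw [hsplit]
  exact vApprox_mul_le_gameValue hn₂ m (realCard_nonneg _) hm

theorem not_takenBy_one (hN : 3 ≤ N) (n : ℕ) : ¬ TakenBy (1 : Equiv.Perm (Fin N)) n := by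
  rintro ⟨i, -, hi⟩
  have hbest := relRank_eq_one_iff.1 hi.2.1 ⟨0, by omega⟩ (Nat.succ_pos _)
  have hi₀ : (i : ℕ) ≤ 0 := hbest
  have := two_le_nStar hN
  have := hi.1
  omega

theorem exists_takenBy_candidateCount_eq_zero (hN : 3 ≤ N) (hn : nStar N ≤ n) :
    ∃ ω : Equiv.Perm (Fin N), TakenBy ω n ∧ candidateCount ω n = 0 := by
  have htwo := two_le_nStar hN
  have hle := nStar_le (N := N) (by omega)
  let z : Fin N := ⟨0, by omega⟩
  obtain ⟨q, hq⟩ : ∃ q : Fin N, (q : ℕ) + 1 = nStar N :=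
    ⟨⟨nStar N - 1, by omega⟩, Nat.sub_add_cancel (by omega)⟩
  have htaken : IsTaken (Equiv.swap z q) q := by
    refine ⟨hq.ge, relRank_eq_one_iff.2 fun j _ => ?_, fun j hj h => by omega⟩
    rw [Equiv.swap_apply_right]
    exact Nat.zero_le _
  refine ⟨Equiv.swap z q, ⟨q, by omega, htaken⟩,
    Finset.card_eq_zero.2 (Finset.filter_eq_empty_iff.2 ?_)⟩
  rintro i - ⟨hi, -, hcand⟩
  have hz : ¬ IsTaken (Equiv.swap z q) z := fun h => by
    have := congrArg Fin.val (h.eq htaken)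
    simp only [z] at this
    omega
  have hiz : i ≠ z := by rintro rfl; simp only [z] at hi; omega
  have hiq : i ≠ q := by rintro rfl; omega
  have hbest := (seenRank_eq_one_iff hcand.1).1 hcand.2 z (Nat.zero_le _) hz
  rw [Equiv.swap_apply_left, Equiv.swap_apply_of_ne_of_ne hiz hiq, Fin.le_def] at hbest
  omega

theorem vApproxBefore_le_vBefore (hN : 3 ≤ N) (n : ℕ) : vApproxBefore N n ≤ vBefore N n :=
  Achievable.le_optimalReward ⟨1, not_takenBy_one hN n⟩
    (achievable_vApproxBefore hN (determinedBy_freeEvent n) subset_rfl)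

theorem vApprox_le_vZero (hN : 3 ≤ N) (hn : nStar N ≤ n) : vApprox N n 0 ≤ vZero N n := by
  have htwo := two_le_nStar hN
  refine Achievable.le_optimalReward (exists_takenBy_candidateCount_eq_zero hN hn)
    (achievable_vApprox (by omega) (by omega) ?_ (fun _ h => h.1) ?_)
  · exact determinedBy_setOf fun ω ω' hs => by
      rw [takenBy_congr hs le_rfl, candidateCount_congr hs le_rfl]
  · rw [Nat.cast_zero, zero_mul]
    exact realCard_nonneg _

theorem vApprox_le_vAt (hN : 3 ≤ N) {m : ℕ} {ω : Equiv.Perm (Fin N)}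
    (h : IsCandidateTime ω m n) : vApprox N n m ≤ vAt ω n := by
  have htwo := two_le_nStar hN
  obtain ⟨hn, ⟨i, rfl, hcand⟩, rfl⟩ := h
  have hT : TakenBy ω (i + 1) := (hcand.takenBy hn.le).mono (Nat.le_succ _)
  exact Achievable.le_optimalReward (E := historyClass ω (i + 1)) ⟨ω, rfl⟩
    (achievable_vApprox (by omega) (by omega) (determinedBy_historyClass ω _)
      (fun _ => takenBy_of_mem_historyClass i.2 hT) (candidateCount_mul_realCard_le i.2 hT))

end StackelbergSecretary

end

theorem lemma2 (N : ℕ) (hN : 3 ≤ N) :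
    (∀ n : ℕ, n ≤ N →
      StackelbergSecretary.vApproxBefore N n ≤ StackelbergSecretary.vBefore N n) ∧
    (∀ n : ℕ, StackelbergSecretary.nStar N ≤ n → n ≤ N →
      StackelbergSecretary.vApprox N n 0 ≤ StackelbergSecretary.vZero N n) ∧
    (∀ (m n : ℕ), 1 ≤ m → ∀ ω : Equiv.Perm (Fin N),
      StackelbergSecretary.IsCandidateTime ω m n →
      StackelbergSecretary.vApprox N n m ≤ StackelbergSecretary.vAt ω n) :=
  ⟨fun n _ => StackelbergSecretary.vApproxBefore_le_vBefore hN n,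
    fun _ hn _ => StackelbergSecretary.vApprox_le_vZero hN hn,
    fun _ _ _ _ h => StackelbergSecretary.vApprox_le_vAt hN h⟩
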